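/- Write $\mathrm e(x)=e^{2\pi i x}$, let $\tau\in\mathbb C$ with $\operatorname{Im}\tau>0$, and put $$\theta(x;\tau)=\sum_{m\in\mathbb Z}\mathrm e\Bigl(\tfrac12(m+\tfrac12)^2\tau+(m+\tfrac12)(x+\tfrac12)\Bigr),\qquad \theta'(x;\tau)=\tfrac{\partial}{\partial x}\theta(x;\tau).$$ For $\vec x=(x',x)\in\mathbb R^2\setminus\mathbb Z^2$ define the elliptic Bernoulli functions $B_m(\vec x;\tau)$, $m\ge 0$, by the Laurent expansion at $X=0$ $$\mathrm e(xX)\,\frac{\theta'(0;\tau)\,\theta(-x'+x\tau+X;\tau)}{\theta(-x'+x\tau;\tau)\,\theta(X;\tau)}=\sum_{m=0}^{\infty}\frac{B_m(\vec x;\tau)}{m!}(2\pi i)^mX^{m-1}.$$ For integers $m,n\ge 0$, a rational number $r=p/q$ in lowest terms with $q\ge1$, and a real matrix $M=\begin{pmatrix}\vec x\\ \vec y\end{pmatrix}\in \mathrm M_2(\mathbb R)$ with rows $\vec x=(x',x)$, $\vec y=(y',y)$ such that $\vec y,\ p\vec y-q\vec x\notin\mathbb Z^2$, let $$S_{m,n}(r,M;\tau)=\frac1q\sum_{\vec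 j\in(\mathbb Z/q\mathbb Z)^2}B_m\Bigl(\frac{\vec j+\vec y}{q};\tau\Bigr)B_n\Bigl(p\,\frac{\vec j+\vec y}{q}-\vec x;\tau\Bigr).$$ For $V=\begin{pmatrix}a&b\\c&d\end{pmatrix}\in \mathrm{SL}_2(\mathbb Z)$ put $j(V,z)=cz+d$, $Vz=(az+b)/(cz+d)$, and $$\mathrm M_2(V)=\Bigl\{\begin{pmatrix}\vec x\\ \vec y\end{pmatrix}\in \mathrm M_2(\mathbb R)\;:\;\vec y\notin\mathbb Z^2,\ c\vec x+d\vec y\notin\mathbb Z^2\Bigr\}.$$ For an integer $l>0$, $M=\begin{pmatrix}\vec x\\ \vec y\end{pmatrix}\in \mathrm M_2(V)$ and $z\in\mathbb C$ with $j(V,z)\neq0$, let $$R_V(l,z,M;\tau)=\frac{(2\pi i)^{l+1}}{(l+1)!}\sum_{k=-1}^{l}\binom{l+1}{k+1}(-j(V,z))^k\,S_{k+1,l-k}\Bigl(\frac dc,\begin{pmatrix}-\vec x\\ \vec y\end{pmatrix};\tau\Bigr)\quad\text{if }c>0,$$ $R_V(l,z,M;\tau)=0$ if $c=0$, and $R_V(l,z,M;\tau)=R_{-V}(l,z,M;\tau)$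 if $c<0$. **Statement.** Let $l$ be a positive integer, let $V,V_1,V_2\in \mathrm{SL}_2(\mathbb Z)$ with $V=V_2V_1$, and let $M\in \mathrm M_2(V)\cap \mathrm M_2(V_1)$. Then for every $z\in\mathbb C$ with $j(V_1,z)\ne0$ and $j(V,z)\neq0$, $$R_{V_1}(l,z,M;\tau)+j(V_1,z)^{l-1}R_{V_2}(l,V_1z,V_1M;\tau)=R_V(l,z,M;\tau),$$ where $V_1M$ is the matrix product. -/

import Mathlib

open scoped MatrixGroups

noncomputable section

namespace EllipticCocycle

/-- `e(x) = exp(2πix)`. -/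
def e (x : ℂ) : ℂ := Complex.exp (2 * Real.pi * Complex.I * x)

/-- Jacobi's theta function
`θ(x;τ) = ∑_{m ∈ ℤ} e((m + 1/2)² τ / 2 + (m + 1/2)(x + 1/2))`. -/
def theta (x τ : ℂ) : ℂ :=
  ∑' m : ℤ, e (1 / 2 * ((m : ℂ) + 1 / 2) ^ 2 * τ + ((m : ℂ) + 1 / 2) * (x + 1 / 2))

/-- The Kronecker double series
`F(x', x; X; τ) = e(xX) θ'(0;τ) θ(-x' + xτ + X;τ) / (θ(-x' + xτ;τ) θ(X;τ))`.
A row vector `v = (x', x)` is stored as `v 0 = x'`, `v 1 = x`. -/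
def F (v : Fin 2 → ℝ) (X τ : ℂ) : ℂ :=
  e (v 1 * X) *
    ((deriv (fun t => theta t τ) 0 * theta (-(v 0 : ℂ) + v 1 * τ + X) τ) /
      (theta (-(v 0 : ℂ) + v 1 * τ) τ * theta X τ))

/-- The function `X ↦ X F(v; X; τ)`, with its removable singularity at `X = 0` removed
(the pole of `F` at `0` is simple when `v ∉ ℤ²` and `Im τ > 0`). -/
def genFun (v : Fin 2 → ℝ) (τ : ℂ) : ℂ → ℂ :=
  Function.update (fun X => X * F v X τ) 0 (Filter.limUnder (nhdsWithin 0 {0}ᶜ) fun X => X * F v X τ)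

/-- The elliptic Bernoulli functions `B_m(v; τ)`, i.e. the coefficients in
`F(v; X; τ) = ∑_{m ≥ 0} B_m(v; τ) / m! (2πi)^m X^(m-1)`. -/
def ellBernoulli (m : ℕ) (v : Fin 2 → ℝ) (τ : ℂ) : ℂ :=
  iteratedDeriv m (genFun v τ) 0 / (2 * Real.pi * Complex.I) ^ m

/-- The elliptic Dedekind-Rademacher sum `S_{m,n}(r, M; τ)`, where `M` has the rows
`x = (x', x)` and `y = (y', y)`:
`(1/d) ∑_{j', j mod d} B_m((j + y)/d; τ) B_n(n (j + y)/d - x; τ)` for `r = n/d` in lowest terms. -/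
def dedekindSum (m n : ℕ) (r : ℚ) (M : Matrix (Fin 2) (Fin 2) ℝ) (τ : ℂ) : ℂ :=
  1 / (r.den : ℂ) *
    ∑ j' ∈ Finset.range r.den, ∑ j ∈ Finset.range r.den,
      ellBernoulli m ((1 / (r.den : ℝ)) • (![(j' : ℝ), (j : ℝ)] + M 1)) τ *
        ellBernoulli n
          (((r.num : ℝ) / (r.den : ℝ)) • (![(j' : ℝ), (j : ℝ)] + M 1) - M 0) τ

/-- The automorphic factor `j(V; z) = cz + d`. -/
def autFactor (V : SL(2, ℤ)) (z : ℂ) : ℂ := (V 1 0 : ℂ) * z + (V 1 1 : ℂ)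

/-- The action `Vz = (az + b)/(cz + d)`; meaningful when `cz + d ≠ 0`. -/
def moebius (V : SL(2, ℤ)) (z : ℂ) : ℂ :=
  ((V 0 0 : ℂ) * z + (V 0 1 : ℂ)) / ((V 1 0 : ℂ) * z + (V 1 1 : ℂ))

/-- The matrix product `VM` for `V ∈ SL₂(ℤ)` and a real matrix `M`. -/
def act (V : SL(2, ℤ)) (M : Matrix (Fin 2) (Fin 2) ℝ) : Matrix (Fin 2) (Fin 2) ℝ :=
  V.1.map (Int.cast : ℤ → ℝ) * M

/-- The lattice `ℤ²` in `ℝ²`. -/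
def intLattice : Set (Fin 2 → ℝ) := {v | ∀ i, ∃ a : ℤ, v i = a}

/-- `M₂(V)`: the real matrices with rows `x, y` such that `y` and `cx + dy` are not in `ℤ²`. -/
def M2 (V : SL(2, ℤ)) : Set (Matrix (Fin 2) (Fin 2) ℝ) :=
  {M | M 1 ∉ intLattice ∧ (V 1 0 : ℝ) • M 0 + (V 1 1 : ℝ) • M 1 ∉ intLattice}

/-- The expression defining `R_V(l, z, M; τ)` for `c > 0`. The summation index is
`m = k + 1`, where `k` runs from `-1` to `l`. -/
def RPos (V : SL(2, ℤ)) (l : ℕ) (z : ℂ) (M : Matrix (Fin 2) (Fin 2) ℝ) (τ : ℂ) : ℂ :=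
  (2 * Real.pi * Complex.I) ^ (l + 1) / ((l + 1).factorial : ℂ) *
    ∑ m ∈ Finset.range (l + 2),
      ((l + 1).choose m : ℂ) * (-autFactor V z) ^ ((m : ℤ) - 1) *
        dedekindSum m (l + 1 - m) ((V 1 1 : ℚ) / (V 1 0 : ℚ)) (Matrix.of ![-M 0, M 1]) τ

/-- `R_V(l, z, M; τ)`. -/
def R (V : SL(2, ℤ)) (l : ℕ) (z : ℂ) (M : Matrix (Fin 2) (Fin 2) ℝ) (τ : ℂ) : ℂ :=
  if 0 < V 1 0 then RPos V l z M τ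
  else if V 1 0 = 0 then 0
  else RPos (-V) l z M τ

end EllipticCocycle

end

/-!
The functions `R_V` are Taylor coefficients. For `V` with bottom row `w = (c, d)`, `c ≠ 0`, and
`J = cz + d`, the number `R_V(l, z, M; τ)` is the coefficient of `T ^ (l - 1)` in
`c⁻¹ ∑ F((j + y) / c; -J T) F(d (j + y) / c + x; T)`, the sum being over `j` modulo `c`
(`exists_genFun_R`). This sum runs over all pairs `(s, t)` of points of the torus `(ℝ/ℤ)²` with
`(0, 1) s + w t = (-y, x)`, so it is a value of the function `pairing`, defined symmetrically for
two integer rows `w₁`, `w₂` and two complex numbers `L₁`, `L₂` by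
`pairing = det(w₁, w₂)⁻¹ ∑ F(s; L₁) F(t; L₂)`, the sum over `w₁ s + w₂ t = μ`. In this form the
change of `M` to `V₁ M` is a change of rows (`pairing_act`), and the theorem becomes the cocycle
relation `pairing(w₁, w₂) + pairing(w₂, w₃) = pairing(w₁, w₃)` for the rows `(0, 1)` and the bottom
rows of `V₁` and `V` (`pairing_add`).

To prove the cocycle relation when no two rows are proportional, multiply each row by the
determinant of the other two. Then the rows add up to zero, and the relation is Fay's trisecant
identity (`fay`) summed over all solutions of the system (`sum_solutions_fay`). Multiplying the rows
refines the set of solutions, but by the distribution relation of the Kronecker function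
(`sum_fiber_kron`) the sums only change by a constant (`sum_solutions_smul`). If two rows are
proportional they are equal up to sign, and the relation reduces to symmetries of `pairing`.

Fay's identity and the distribution relation both follow from Liouville's theorem in the form
`exists_const_of_quasiperiodic`: a function without poles that is multiplied by a nontrivial unitary
character under the periods `1`, `τ` vanishes. It applies because `F(v; X; τ)` has such multipliers,
with simple poles exactly at the periods. The location of the poles rests on that of the zeros of
`θ`, which is read off from Jacobi's product (`exists_theta_eq_thetaProd`), itself another
application of Liouville's theorem.
-/

namespace EllipticCocycle

open Filter Topology

/-! ### Quasi-periodic functions without poles -/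

/-- `f` has an analytic continuation to `x`: near `x`, but perhaps not at `x` itself, it agrees
with a function analytic at `x`. -/
def Removable (f : ℂ → ℂ) (x : ℂ) : Prop :=
  ∃ g : ℂ → ℂ, AnalyticAt ℂ g x ∧ f =ᶠ[𝓝[≠] x] g

theorem removable_of_analyticAt {f : ℂ → ℂ} {x : ℂ} (hf : AnalyticAt ℂ f x) : Removable f x :=
  ⟨f, hf, EventuallyEq.rfl⟩

/-- A meromorphic function with at most a simple pole and vanishing residue has an analytic
continuation. -/
theorem removable_of_tendsto {f : ℂ → ℂ} {x : ℂ} (hf : MeromorphicAt f x)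
    (h : Tendsto (fun z => (z - x) * f z) (𝓝[≠] x) (𝓝 0)) : Removable f x := by
  have hm : MeromorphicAt (fun z : ℂ => z - x) x := by fun_prop
  have h1 : meromorphicOrderAt (fun z : ℂ => z - x) x = 1 := by
    rw [show (1 : WithTop ℤ) = ((1 : ℤ) : WithTop ℤ) from rfl, meromorphicOrderAt_eq_int_iff hm]
    exact ⟨fun _ => 1, analyticAt_const, one_ne_zero, by simp⟩
  have h2 := (tendsto_zero_iff_meromorphicOrderAt_pos (hm.mul hf)).1 h
  rw [meromorphicOrderAt_mul hm hf, h1] at h2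
  have h3 : 0 ≤ meromorphicOrderAt f x := by
    cases hk : meromorphicOrderAt f x with
    | top => exact le_top
    | coe k =>
      rw [hk, show (1 : WithTop ℤ) = ((1 : ℤ) : WithTop ℤ) from rfl, ← WithTop.coe_add] at h2
      have : (0 : ℤ) < 1 + k := by exact_mod_cast h2
      exact_mod_cast (by omega : (0 : ℤ) ≤ k)
  exact ⟨_, hf.meromorphicOrderAt_nonneg_iff_analyticAt_toMeromorphicNFAt.1 h3,
    hf.eq_nhdsNE_toMeromorphicNFAt⟩

theorem eq_of_eventuallyEq_nhdsNE {g₁ g₂ : ℂ → ℂ} {x : ℂ} (h₁ : ContinuousAt g₁ x)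
    (h₂ : ContinuousAt g₂ x) (h : g₁ =ᶠ[𝓝[≠] x] g₂) : g₁ x = g₂ x :=
  tendsto_nhds_unique (h₁.tendsto.mono_left nhdsWithin_le_nhds)
    ((h₂.tendsto.mono_left nhdsWithin_le_nhds).congr' h.symm)

theorem lim_eq_of_eventuallyEq {f g : ℂ → ℂ} {x : ℂ} (hg : ContinuousAt g x)
    (h : f =ᶠ[𝓝[≠] x] g) : limUnder (𝓝[≠] x) f = g x :=
  ((hg.tendsto.mono_left nhdsWithin_le_nhds).congr' h.symm).limUnder_eq

/-- If all singularities are removable, filling them in gives an entire function. -/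
theorem differentiable_lim {f : ℂ → ℂ} (hf : ∀ x, Removable f x) :
    Differentiable ℂ fun x => limUnder (𝓝[≠] x) f := by
  intro x
  obtain ⟨g, hg, hfg⟩ := hf x
  have h1 : ∀ᶠ y in 𝓝 x, AnalyticAt ℂ g y := hg.eventually_analyticAt
  have h2 : ∀ᶠ y in 𝓝[≠] x, f =ᶠ[𝓝 y] g := by
    have := eventually_eventually_nhdsWithin.2 hfg
    filter_upwards [this, self_mem_nhdsWithin] with y hy hyx
    exact hy.filter_mono (by
      rw [(isOpen_compl_singleton (x := x)).nhdsWithin_eq hyx])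
  have h3 : (fun x => limUnder (𝓝[≠] x) f) =ᶠ[𝓝 x] g := by
    filter_upwards [eventually_nhdsWithin_iff.1 h2, h1] with y hy hgy
    rcases eq_or_ne y x with rfl | hyx
    · exact lim_eq_of_eventuallyEq hgy.continuousAt hfg
    · exact lim_eq_of_eventuallyEq hgy.continuousAt ((hy hyx).filter_mono nhdsWithin_le_nhds)
  exact hg.differentiableAt.congr_of_eventuallyEq h3

theorem isBounded_of_periods {τ : ℂ} (hτ : 0 < τ.im) {h : ℂ → ℂ} (hc : Continuous h)
    {a b : ℂ} (ha : ‖a‖ = 1) (hb : ‖b‖ = 1) (h1 : ∀ x, h (x + 1) = a * h x)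
    (h2 : ∀ x, h (x + τ) = b * h x) : Bornology.IsBounded (Set.range h) := by
  -- every value has the modulus of a value on the compact period parallelogram
  have n1 : ∀ x, ‖h (x + 1)‖ = ‖h x‖ := fun x => by rw [h1, norm_mul, ha, one_mul]
  have n2 : ∀ x, ‖h (x + τ)‖ = ‖h x‖ := fun x => by rw [h2, norm_mul, hb, one_mul]
  have n1' : Function.Periodic (fun x => ‖h x‖) 1 := n1
  have n2' : Function.Periodic (fun x => ‖h x‖) τ := n2
  let p : ℝ × ℝ → ℂ := fun t => t.1 * τ + t.2
  have hp : Continuous p := by fun_prop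
  have hK : IsCompact (p '' (Set.Icc 0 1 ×ˢ Set.Icc 0 1)) :=
    (isCompact_Icc.prod isCompact_Icc).image hp
  obtain ⟨C, hC⟩ := (hK.image hc).isBounded.exists_norm_le
  refine isBounded_iff_forall_norm_le.2 ⟨C, ?_⟩
  rintro _ ⟨x, rfl⟩
  set s : ℝ := x.im / τ.im with hs
  set t : ℝ := x.re - s * τ.re with ht
  have hx : x = s * τ + t := by
    apply Complex.ext
    · simp [ht]
    · simp [hs, hτ.ne']
  have e1 : ‖h x‖ = ‖h (p (Int.fract s, Int.fract t))‖ := by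
    have q1 : ‖h (p (Int.fract s, Int.fract t) + ⌊s⌋ * τ)‖ = ‖h (p (Int.fract s, Int.fract t))‖ :=
      n2'.int_mul ⌊s⌋ _
    have q2 : ‖h (p (Int.fract s, Int.fract t) + ⌊s⌋ * τ + ⌊t⌋ * 1)‖ =
        ‖h (p (Int.fract s, Int.fract t) + ⌊s⌋ * τ)‖ := n1'.int_mul ⌊t⌋ _
    rw [← q1, ← q2, hx]
    congr 2
    simp only [p, Int.fract]
    push_cast
    ring
  rw [e1]
  refine hC _ ⟨_, ⟨(Int.fract s, Int.fract t), ?_, rfl⟩, rfl⟩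
  exact ⟨⟨Int.fract_nonneg _, (Int.fract_lt_one _).le⟩,
    ⟨Int.fract_nonneg _, (Int.fract_lt_one _).le⟩⟩

/-- Liouville's theorem for functions that are multiplied by unimodular constants under the
periods `1` and `τ`. -/
theorem exists_const_of_quasiperiodic {τ : ℂ} (hτ : 0 < τ.im) {f : ℂ → ℂ}
    (hf : ∀ x, Removable f x) {a b : ℂ} (ha : ‖a‖ = 1) (hb : ‖b‖ = 1)
    (h1 : ∀ x, f (x + 1) = a * f x) (h2 : ∀ x, f (x + τ) = b * f x) :
    ∃ c, (∀ x, ContinuousAt f x → f x = c) ∧ (a ≠ 1 ∨ b ≠ 1 → c = 0) := by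
  set h : ℂ → ℂ := fun x => limUnder (𝓝[≠] x) f with hh
  have hd : Differentiable ℂ h := differentiable_lim hf
  have shift : ∀ w a : ℂ, (∀ x, f (x + w) = a * f x) → ∀ x, h (x + w) = a * h x := by
    intro w a hw x
    obtain ⟨g, hg, hfg⟩ := hf x
    obtain ⟨k, hk, hfk⟩ := hf (x + w)
    have t : Tendsto (fun y => y + w) (𝓝[≠] x) (𝓝[≠] (x + w)) :=
      tendsto_nhdsWithin_iff.2 ⟨((continuous_add_const w).tendsto x).mono_left nhdsWithin_le_nhds,
        eventually_mem_nhdsWithin.mono fun y hy => by simpa using hy⟩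
    have e : (fun y => k (y + w)) =ᶠ[𝓝[≠] x] fun y => a * g y := by
      filter_upwards [t.eventually hfk, hfg] with y h1 h2
      rw [← h1, hw, h2]
    have e2 := eq_of_eventuallyEq_nhdsNE
      (ContinuousAt.comp (f := fun y => y + w) hk.continuousAt (by fun_prop))
      (continuousAt_const.mul hg.continuousAt) e
    simp only [hh]
    rw [lim_eq_of_eventuallyEq hk.continuousAt hfk, lim_eq_of_eventuallyEq hg.continuousAt hfg]
    exact e2
  have s1 := shift 1 a h1
  have s2 := shift τ b h2
  obtain ⟨c, hc⟩ := hd.exists_const_forall_eq_of_bounded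
    (isBounded_of_periods hτ hd.continuous ha hb s1 s2)
  refine ⟨c, fun x hx => ?_, ?_⟩
  · rw [← hc x]
    exact (lim_eq_of_eventuallyEq hx EventuallyEq.rfl).symm
  · have t1 := s1 0
    have t2 := s2 0
    rw [hc, hc] at t1 t2
    rintro (h | h) <;> by_contra hc0
    · exact h (mul_right_cancel₀ hc0 (by rw [← t1, one_mul]))
    · exact h (mul_right_cancel₀ hc0 (by rw [← t2, one_mul]))

/-! ### The exponential `e` -/

theorem e_add (x y : ℂ) : e (x + y) = e x * e y := by
  simp only [e, mul_add, Complex.exp_add]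

theorem e_ne_zero (x : ℂ) : e x ≠ 0 := Complex.exp_ne_zero _

@[simp] theorem e_zero : e 0 = 1 := by simp [e]

theorem e_neg (x : ℂ) : e (-x) = (e x)⁻¹ := by simp only [e, mul_neg, Complex.exp_neg]

theorem e_nat_mul (n : ℕ) (x : ℂ) : e (n * x) = e x ^ n := by
  rw [e, e, ← Complex.exp_nat_mul]; ring_nf

theorem e_int_mul (n : ℤ) (x : ℂ) : e (n * x) = e x ^ n := by
  rw [e, e, ← Complex.exp_int_mul]; ring_nf

@[simp] theorem e_one : e 1 = 1 := by simp [e, Complex.exp_two_pi_mul_I]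

@[simp] theorem e_half : e (1 / 2) = -1 := by
  rw [e, show 2 * (Real.pi : ℂ) * Complex.I * (1 / 2) = Real.pi * Complex.I by ring,
    Complex.exp_pi_mul_I]

@[simp] theorem e_intCast (n : ℤ) : e n = 1 := by
  rw [← mul_one (n : ℂ), e_int_mul]; simp

theorem e_eq_one_iff {x : ℂ} : e x = 1 ↔ ∃ n : ℤ, x = n := by
  refine ⟨fun h => ?_, fun ⟨n, hn⟩ => by rw [hn, e_intCast]⟩
  obtain ⟨n, hn⟩ := Complex.exp_eq_one_iff.1 h
  exact ⟨n, mul_left_cancel₀ Complex.two_pi_I_ne_zero (by rw [hn]; ring)⟩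

@[fun_prop] theorem differentiable_e : Differentiable ℂ e := by unfold e; fun_prop

theorem hasDerivAt_e_zero : HasDerivAt e (2 * Real.pi * Complex.I) 0 := by
  have h := ((hasDerivAt_id (0 : ℂ)).const_mul (2 * (Real.pi : ℂ) * Complex.I)).cexp
  simpa [e] using! h

theorem norm_e (x : ℂ) : ‖e x‖ = Real.exp (-(2 * Real.pi * x.im)) := by
  simp [e, Complex.norm_exp]

theorem norm_e_lt_one {τ : ℂ} (hτ : 0 < τ.im) : ‖e τ‖ < 1 := by
  rw [norm_e, Real.exp_lt_one_iff]
  have := Real.pi_pos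
  nlinarith [mul_pos this hτ]

/-! ### The lattice of periods -/

/-- `x` lies in the lattice `ℤτ + ℤ`. -/
def IsPeriod (τ x : ℂ) : Prop := ∃ m k : ℤ, x = m * τ + k

theorem isPeriod_zero (τ : ℂ) : IsPeriod τ 0 := ⟨0, 0, by simp⟩

theorem IsPeriod.neg {τ x : ℂ} (h : IsPeriod τ x) : IsPeriod τ (-x) := by
  obtain ⟨m, k, rfl⟩ := h
  exact ⟨-m, -k, by push_cast; ring⟩

theorem isPeriod_neg {τ x : ℂ} : IsPeriod τ (-x) ↔ IsPeriod τ x :=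
  ⟨fun h => by simpa using h.neg, IsPeriod.neg⟩

theorem IsPeriod.add {τ x y : ℂ} (h : IsPeriod τ x) (h' : IsPeriod τ y) :
    IsPeriod τ (x + y) := by
  obtain ⟨m, k, rfl⟩ := h
  obtain ⟨m', k', rfl⟩ := h'
  exact ⟨m + m', k + k', by push_cast; ring⟩

theorem IsPeriod.int_mul {τ x : ℂ} (h : IsPeriod τ x) (n : ℤ) : IsPeriod τ (n * x) := by
  obtain ⟨m, k, rfl⟩ := h
  exact ⟨n * m, n * k, by push_cast; ring⟩

/-! ### The infinite product -/

/-- The product `∏_{n ≥ 0} (1 - qⁿ w)`. -/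
noncomputable def qProd (q w : ℂ) : ℂ := ∏' n : ℕ, (1 - q ^ n * w)

theorem summable_qProd {q : ℂ} (hq : ‖q‖ < 1) (w : ℂ) : Summable fun n : ℕ => ‖-(q ^ n * w)‖ := by
  simpa using (summable_geometric_of_lt_one (norm_nonneg q) hq).mul_right ‖w‖

theorem qProd_eq {q : ℂ} (hq : ‖q‖ < 1) (w : ℂ) : qProd q w = (1 - w) * qProd q (q * w) := by
  have h : Multipliable fun n : ℕ => 1 - q ^ n * (q * w) := by
    simpa only [sub_eq_add_neg] using multipliable_one_add_of_summable (summable_qProd hq (q * w))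
  have h' : Multipliable fun n : ℕ => 1 - q ^ (n + 1) * w := by
    simpa only [pow_succ, mul_assoc] using h
  rw [qProd, tprod_eq_zero_mul' (f := fun n : ℕ => 1 - q ^ n * w) h', pow_zero, one_mul, qProd]
  simp only [pow_succ, mul_assoc]

theorem qProd_ne_zero {q : ℂ} (hq : ‖q‖ < 1) {w : ℂ} (hw : ∀ n : ℕ, q ^ n * w ≠ 1) :
    qProd q w ≠ 0 := by
  have := tprod_one_add_ne_zero_of_summable (f := fun n : ℕ => -(q ^ n * w))
    (fun n => by rw [← sub_eq_add_neg]; exact sub_ne_zero.2 (hw n).symm) (summable_qProd hq w)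
  simpa [qProd, sub_eq_add_neg] using this

theorem differentiable_qProd {q : ℂ} (hq : ‖q‖ < 1) : Differentiable ℂ (qProd q) := by
  have h : HasProdLocallyUniformlyOn (fun (n : ℕ) w => 1 - q ^ n * w) (qProd q) Set.univ := by
    refine hasProdLocallyUniformlyOn_of_forall_compact isOpen_univ fun K _ hK => ?_
    obtain ⟨C, hC⟩ := hK.isBounded.exists_norm_le
    have := ((summable_geometric_of_lt_one (norm_nonneg q) hq).mul_right
      C).hasProdUniformlyOn_nat_one_add (f := fun n w => -(q ^ n * w)) hK
      (.of_forall fun n x hx => by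
        rw [norm_neg, norm_mul, norm_pow]
        exact mul_le_mul_of_nonneg_left (hC x hx) (by positivity)) (fun _ => by fun_prop)
    simpa only [← sub_eq_add_neg] using! this
  rw [← differentiableOn_univ]
  exact h.differentiableOn (.of_forall fun _ => by
    simpa [Finset.prod_fn] using DifferentiableOn.finsetProd (fun _ _ => by fun_prop)) isOpen_univ

/-- The product side of Jacobi's triple product, up to a constant:
`(e(x/2) - e(-x/2)) ∏_{n ≥ 1} (1 - qⁿ e(x)) (1 - qⁿ e(-x))` with `q = e(τ)`. -/
noncomputable def thetaProd (x τ : ℂ) : ℂ :=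
  (e (x / 2) - e (-(x / 2))) * (qProd (e τ) (e τ * e x) * qProd (e τ) (e τ * e (-x)))

theorem differentiable_thetaProd {τ : ℂ} (hτ : 0 < τ.im) :
    Differentiable ℂ fun x => thetaProd x τ := by
  have h := differentiable_qProd (norm_e_lt_one hτ)
  have h1 : Differentiable ℂ fun x => qProd (e τ) (e τ * e x) := h.comp (by fun_prop)
  have h2 : Differentiable ℂ fun x => qProd (e τ) (e τ * e (-x)) := h.comp (by fun_prop)
  have h3 : Differentiable ℂ fun x : ℂ => e (x / 2) - e (-(x / 2)) := by fun_prop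
  exact h3.mul (h1.mul h2)

theorem thetaProd_add_one (x τ : ℂ) : thetaProd (x + 1) τ = -thetaProd x τ := by
  have h1 : e (x + 1) = e x := by rw [e_add, e_one, mul_one]
  have h2 : e (-(x + 1)) = e (-x) := by rw [e_neg, e_neg, h1]
  have h3 : e ((x + 1) / 2) = -e (x / 2) := by rw [add_div, e_add, e_half]; ring
  have h4 : e (-((x + 1) / 2)) = -e (-(x / 2)) := by rw [e_neg, h3, e_neg, inv_neg]
  simp only [thetaProd, h1, h2, h3, h4]
  ring

theorem thetaProd_add_tau {τ : ℂ} (hτ : 0 < τ.im) (x : ℂ) :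
    thetaProd (x + τ) τ = -e (-τ / 2 - x) * thetaProd x τ := by
  have hq := norm_e_lt_one hτ
  have a1 := qProd_eq hq (e τ * e x)
  have a2 := qProd_eq hq (e (-x))
  have b1 : e τ * e (x + τ) = e τ * (e τ * e x) := by rw [e_add]; ring
  have b2 : e τ * e (-(x + τ)) = e (-x) := by rw [← e_add]; congr 1; ring
  have b3 : e ((x + τ) / 2) - e (-((x + τ) / 2)) = -e (-((x + τ) / 2)) * (1 - e τ * e x) := by
    have : e ((x + τ) / 2) = e (-((x + τ) / 2)) * (e τ * e x) := by
      rw [← e_add, ← e_add]; congr 1; ring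
    rw [this]; ring
  have b4 : e (x / 2) - e (-(x / 2)) = e (x / 2) * (1 - e (-x)) := by
    have : e (-(x / 2)) = e (x / 2) * e (-x) := by rw [← e_add]; congr 1; ring
    rw [this]; ring
  have b5 : e (-((x + τ) / 2)) = e (-τ / 2 - x) * e (x / 2) := by rw [← e_add]; congr 1; ring
  simp only [thetaProd, b1, b2, b3, b4]
  rw [a1, a2, b5]
  ring

/-- The factors of the product vanish only at periods. -/
theorem isPeriod_of_thetaProd_eq_zero {τ : ℂ} (hτ : 0 < τ.im) {x : ℂ}
    (h : thetaProd x τ = 0) : IsPeriod τ x := by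
  have hq := norm_e_lt_one hτ
  have key : ∀ y : ℂ, qProd (e τ) (e τ * e y) = 0 → IsPeriod τ y := by
    intro y hy
    by_contra hy'
    refine qProd_ne_zero hq (fun n hn => hy' ?_) hy
    rw [← e_nat_mul, ← e_add, ← e_add, e_eq_one_iff] at hn
    obtain ⟨k, hk⟩ := hn
    exact ⟨-(n + 1), k, by rw [← hk]; push_cast; ring⟩
  rcases mul_eq_zero.1 h with h | h
  · have h1 : e x = 1 := by
      have : e x = e (x / 2) * e (x / 2) := by rw [← e_add]; congr 1; ring
      rw [this]
      nth_rw 2 [sub_eq_zero.1 h]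
      rw [← e_add, add_neg_cancel, e_zero]
    obtain ⟨k, hk⟩ := e_eq_one_iff.1 h1
    exact ⟨0, k, by simp [hk]⟩
  · rcases mul_eq_zero.1 h with h | h
    · exact key x h
    · exact isPeriod_neg.1 (key _ h)

theorem deriv_thetaProd_zero {τ : ℂ} (hτ : 0 < τ.im) : deriv (fun x => thetaProd x τ) 0 ≠ 0 := by
  have hq := norm_e_lt_one hτ
  have h := differentiable_qProd hq
  have h1 : Differentiable ℂ fun x => qProd (e τ) (e τ * e x) := h.comp (by fun_prop)
  have h2 : Differentiable ℂ fun x => qProd (e τ) (e τ * e (-x)) := h.comp (by fun_prop)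
  have e0 : HasDerivAt e (2 * Real.pi * Complex.I) (0 / 2) := by
    simpa using hasDerivAt_e_zero
  have e0' : HasDerivAt e (2 * Real.pi * Complex.I) (-(0 / 2)) := by
    simpa using hasDerivAt_e_zero
  have h3 : HasDerivAt (fun x : ℂ => e (x / 2) - e (-(x / 2))) (2 * Real.pi * Complex.I) 0 := by
    have a := e0.comp (0 : ℂ) ((hasDerivAt_id (0 : ℂ)).div_const 2)
    have b := e0'.comp (0 : ℂ) ((hasDerivAt_id (0 : ℂ)).div_const 2).neg
    convert! a.sub b using 1
    ring
  have h4 := (h3.mul ((h1 0).mul (h2 0)).hasDerivAt).deriv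
  have h5 : qProd (e τ) (e τ) ≠ 0 := by
    refine qProd_ne_zero hq fun n hn => ?_
    rw [← pow_succ] at hn
    have : ‖e τ‖ ^ (n + 1) < 1 := pow_lt_one₀ (norm_nonneg _) hq (by omega)
    rw [← norm_pow, hn, norm_one] at this
    exact lt_irrefl _ this
  have h6 : deriv (fun x => thetaProd x τ) 0 =
      2 * Real.pi * Complex.I * (qProd (e τ) (e τ) * qProd (e τ) (e τ)) := by
    refine Eq.trans h4 ?_
    simp
  rw [h6]
  exact mul_ne_zero Complex.two_pi_I_ne_zero (mul_ne_zero h5 h5)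

/-! ### Zeros of the theta function -/

theorem theta_eq_jacobiTheta₂ (x τ : ℂ) :
    theta x τ = e (τ / 8 + x / 2 + 1 / 4) * jacobiTheta₂ (x + 1 / 2 + τ / 2) τ := by
  rw [theta, jacobiTheta₂, ← tsum_mul_left]
  refine tsum_congr fun m => ?_
  rw [jacobiTheta₂_term, e, e, ← Complex.exp_add]
  congr 1
  ring

theorem differentiable_theta {τ : ℂ} (hτ : 0 < τ.im) : Differentiable ℂ fun x => theta x τ := by
  simp only [theta_eq_jacobiTheta₂]
  have h : Differentiable ℂ fun x => jacobiTheta₂ x τ := fun x =>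
    differentiableAt_jacobiTheta₂_fst x hτ
  have h1 : Differentiable ℂ fun x : ℂ => jacobiTheta₂ (x + 1 / 2 + τ / 2) τ := h.comp (by fun_prop)
  have h2 : Differentiable ℂ fun x : ℂ => e (τ / 8 + x / 2 + 1 / 4) := by fun_prop
  exact h2.mul h1

theorem theta_add_one (x τ : ℂ) : theta (x + 1) τ = -theta x τ := by
  rw [theta_eq_jacobiTheta₂, theta_eq_jacobiTheta₂,
    show x + 1 + 1 / 2 + τ / 2 = x + 1 / 2 + τ / 2 + 1 by ring, jacobiTheta₂_add_left,
    show τ / 8 + (x + 1) / 2 + 1 / 4 = τ / 8 + x / 2 + 1 / 4 + 1 / 2 by ring,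
    e_add _ (1 / 2), e_half]
  ring

theorem theta_add_tau (x τ : ℂ) : theta (x + τ) τ = -e (-τ / 2 - x) * theta x τ := by
  rw [theta_eq_jacobiTheta₂, theta_eq_jacobiTheta₂,
    show x + τ + 1 / 2 + τ / 2 = x + 1 / 2 + τ / 2 + τ by ring, jacobiTheta₂_add_left',
    show Complex.exp (-Real.pi * Complex.I * (τ + 2 * (x + 1 / 2 + τ / 2))) =
      e (-τ - x - 1 / 2) by rw [e]; congr 1; ring]
  have : e (τ / 8 + (x + τ) / 2 + 1 / 4) * e (-τ - x - 1 / 2) =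
      -e (-τ / 2 - x) * e (τ / 8 + x / 2 + 1 / 4) := by
    have h : e (-(1 / 2)) = -1 := by rw [e_neg, e_half]; norm_num
    rw [neg_mul, ← e_add, ← e_add, ← neg_one_mul (e (-τ / 2 - x + _)), ← h, ← e_add]
    congr 1
    ring
  linear_combination this * jacobiTheta₂ (x + 1 / 2 + τ / 2) τ

theorem theta_neg (x τ : ℂ) : theta (-x) τ = -theta x τ := by
  rw [theta_eq_jacobiTheta₂, theta_eq_jacobiTheta₂, ← jacobiTheta₂_neg_left]
  have h1 := jacobiTheta₂_add_left' (-(-x + 1 / 2 + τ / 2)) τ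
  have h2 := jacobiTheta₂_add_left (-(-x + 1 / 2 + τ / 2) + τ) τ
  rw [h1, show -(-x + 1 / 2 + τ / 2) + τ + 1 = x + 1 / 2 + τ / 2 by ring] at h2
  rw [h2, show Complex.exp (-Real.pi * Complex.I * (τ + 2 * -(-x + 1 / 2 + τ / 2))) =
    e (1 / 2 - x) by rw [e]; congr 1; ring]
  have : e (τ / 8 + x / 2 + 1 / 4) * e (1 / 2 - x) = -e (τ / 8 + -x / 2 + 1 / 4) := by
    rw [← neg_one_mul, ← e_half, ← e_add, ← e_add]
    congr 1
    ring
  linear_combination this * jacobiTheta₂ (-(-x + 1 / 2 + τ / 2)) τ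

@[simp] theorem theta_zero (τ : ℂ) : theta 0 τ = 0 := by
  have := theta_neg 0 τ
  rw [neg_zero] at this
  exact self_eq_neg.1 this

/-- A function with the quasi-periodicity of `θ` that vanishes at `0` vanishes at all periods. -/
theorem eq_zero_of_isPeriod {τ : ℂ} {g : ℂ → ℂ} (h0 : g 0 = 0) (h1 : ∀ x, g (x + 1) = -g x)
    (h2 : ∀ x, g (x + τ) = -e (-τ / 2 - x) * g x) {x : ℂ} (hx : IsPeriod τ x) : g x = 0 := by
  have t1 : ∀ x, g (x + 1) = 0 ↔ g x = 0 := fun x => by rw [h1, neg_eq_zero]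
  have t2 : ∀ x, g (x + τ) = 0 ↔ g x = 0 := fun x => by
    rw [h2, mul_eq_zero, or_iff_right (neg_ne_zero.2 (e_ne_zero _))]
  have p1 : Function.Periodic (fun x => g x = 0) 1 := fun x => propext (t1 x)
  have p2 : Function.Periodic (fun x => g x = 0) τ := fun x => propext (t2 x)
  obtain ⟨m, k, rfl⟩ := hx
  have e1 : (g (m * τ + k * 1) = 0) = (g (m * τ) = 0) := p1.int_mul k _
  have e2 : (g (0 + m * τ) = 0) = (g 0 = 0) := p2.int_mul m _
  rw [zero_add] at e2
  rw [mul_one] at e1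
  rw [e1, e2, h0]

theorem theta_eq_zero_of_isPeriod {τ x : ℂ} (h : IsPeriod τ x) : theta x τ = 0 :=
  eq_zero_of_isPeriod (g := fun x => theta x τ) (theta_zero τ) (fun x => theta_add_one x τ)
    (fun x => theta_add_tau x τ) h

theorem thetaProd_eq_zero_of_isPeriod {τ : ℂ} (hτ : 0 < τ.im) {x : ℂ} (h : IsPeriod τ x) :
    thetaProd x τ = 0 :=
  eq_zero_of_isPeriod (g := fun x => thetaProd x τ) (by simp [thetaProd])
    (fun x => thetaProd_add_one x τ) (thetaProd_add_tau hτ) h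

theorem tendsto_id_div_of_deriv_ne_zero {g : ℂ → ℂ} (hg : DifferentiableAt ℂ g 0) (h0 : g 0 = 0)
    (h1 : deriv g 0 ≠ 0) : Tendsto (fun z => z / g z) (𝓝[≠] 0) (𝓝 (deriv g 0)⁻¹) := by
  have := (hasDerivAt_iff_tendsto_slope_zero.1 hg.hasDerivAt).inv₀ h1
  refine this.congr fun z => ?_
  rw [zero_add, h0, sub_zero, smul_eq_mul, mul_inv, inv_inv, div_eq_mul_inv]

theorem tendsto_sub_nhdsNE (x y : ℂ) : Tendsto (fun z => z - y) (𝓝[≠] x) (𝓝[≠] (x - y)) :=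
  tendsto_nhdsWithin_iff.2 ⟨((continuous_sub_right y).tendsto x).mono_left nhdsWithin_le_nhds,
    eventually_mem_nhdsWithin.mono fun z hz => by simpa using hz⟩

/-- The zeroth Fourier coefficient of `z ↦ ∑ exp(πi n² τ + 2πi n z)` is `1`. -/
theorem exists_jacobiTheta₂_ne_zero {τ : ℂ} (hτ : 0 < τ.im) : ∃ z, jacobiTheta₂ z τ ≠ 0 := by
  by_contra! h0
  have hn : ∀ (n : ℤ) (x : ℝ), ‖jacobiTheta₂_term n x τ‖ = ‖jacobiTheta₂_term n 0 τ‖ := by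
    intro n x
    simp [norm_jacobiTheta₂_term]
  have hs : Summable fun n : ℤ => ‖jacobiTheta₂_term n 0 τ‖ :=
    ((summable_jacobiTheta₂_term_iff 0 τ).2 hτ).norm
  have key := intervalIntegral.hasSum_integral_of_dominated_convergence
    (μ := MeasureTheory.volume) (a := (0 : ℝ)) (b := 1)
    (F := fun (n : ℤ) (x : ℝ) => jacobiTheta₂_term n x τ) (f := fun _ => (0 : ℂ))
    (fun n _ => ‖jacobiTheta₂_term n 0 τ‖)
    (fun n => by unfold jacobiTheta₂_term; exact (by fun_prop : Continuous _).aestronglyMeasurable)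
    (fun n => .of_forall fun x _ => (hn n x).le) (.of_forall fun x _ => hs)
    (by simp) (.of_forall fun x _ => by
      rw [← h0 x]; exact hasSum_jacobiTheta₂_term x hτ)
  have hi : ∀ n : ℤ, n ≠ 0 → ∫ x in (0 : ℝ)..1, jacobiTheta₂_term n x τ = 0 := by
    intro n hn
    have hc : (2 * Real.pi * Complex.I * n : ℂ) ≠ 0 :=
      mul_ne_zero Complex.two_pi_I_ne_zero (by exact_mod_cast hn)
    have : ∀ x : ℝ, jacobiTheta₂_term n x τ =
        Complex.exp (Real.pi * Complex.I * n ^ 2 * τ) *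
          Complex.exp (2 * Real.pi * Complex.I * n * x) := by
      intro x
      rw [jacobiTheta₂_term, ← Complex.exp_add, add_comm]
    simp only [this]
    rw [intervalIntegral.integral_const_mul, integral_exp_mul_complex hc]
    have h1 : Complex.exp (2 * Real.pi * Complex.I * n * (1 : ℝ)) = 1 := by
      rw [← e_intCast n, e]; simp
    rw [h1]
    simp
  have h1 := key.unique (hasSum_single (0 : ℤ) hi)
  simp [jacobiTheta₂_term] at h1

/-- Jacobi's triple product, with an unspecified nonzero constant: the quotient of the two sides is
an elliptic function without poles. -/
theorem exists_theta_eq_thetaProd {τ : ℂ} (hτ : 0 < τ.im) :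
    ∃ c : ℂ, c ≠ 0 ∧ ∀ x, theta x τ = c * thetaProd x τ := by
  have dθ := differentiable_theta hτ
  have dP := differentiable_thetaProd hτ
  have aθ : ∀ x, AnalyticAt ℂ (fun x => theta x τ) x := fun x => dθ.analyticAt x
  have aP : ∀ x, AnalyticAt ℂ (fun x => thetaProd x τ) x := fun x => dP.analyticAt x
  have hana : ∀ x, ¬ IsPeriod τ x → AnalyticAt ℂ (fun x => theta x τ / thetaProd x τ) x :=
    fun x hx => (aθ x).div (aP x) fun h => hx (isPeriod_of_thetaProd_eq_zero hτ h)
  have q1 : ∀ x, theta (x + 1) τ / thetaProd (x + 1) τ = 1 * (theta x τ / thetaProd x τ) := by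
    intro x
    rw [theta_add_one, thetaProd_add_one, neg_div_neg_eq, one_mul]
  have q2 : ∀ x, theta (x + τ) τ / thetaProd (x + τ) τ = 1 * (theta x τ / thetaProd x τ) := by
    intro x
    rw [theta_add_tau, thetaProd_add_tau hτ, mul_div_mul_left _ _ (neg_ne_zero.2 (e_ne_zero _)),
      one_mul]
  have hrem : ∀ x, Removable (fun x => theta x τ / thetaProd x τ) x := by
    intro x
    by_cases hx : IsPeriod τ x
    · refine removable_of_tendsto ((aθ x).meromorphicAt.div (aP x).meromorphicAt) ?_
      have l1 := tendsto_id_div_of_deriv_ne_zero (dP 0)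
        (thetaProd_eq_zero_of_isPeriod hτ (isPeriod_zero τ)) (deriv_thetaProd_zero hτ)
      have l2 : Tendsto (fun x => theta x τ) (𝓝[≠] 0) (𝓝 0) := by
        have := (dθ 0).continuousAt.tendsto.mono_left (nhdsWithin_le_nhds (s := {0}ᶜ))
        simpa only [theta_zero] using this
      have l3 := tendsto_sub_nhdsNE x x
      rw [sub_self] at l3
      have l4 := (l1.mul l2).comp l3
      rw [mul_zero] at l4
      refine l4.congr fun z => ?_
      -- `θ / thetaProd` has periods `1` and `τ`, so the period `x` may be replaced by `0`
      have hp : theta z τ / thetaProd z τ = theta (z - x) τ / thetaProd (z - x) τ := by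
        obtain ⟨m, k, rfl⟩ := hx
        have p1 : Function.Periodic (fun x => theta x τ / thetaProd x τ) 1 :=
          fun x => (q1 x).trans (one_mul _)
        have p2 : Function.Periodic (fun x => theta x τ / thetaProd x τ) τ :=
          fun x => (q2 x).trans (one_mul _)
        have e1 := (p1.int_mul k (z - (m * τ + k) + m * τ)).symm
        have e2 := (p2.int_mul m (z - (m * τ + k))).symm
        refine Eq.trans ?_ (e2.trans e1).symm
        congr 2 <;> ring
      simp only [Function.comp, hp]
      ring
    · exact removable_of_analyticAt (hana x hx)
  obtain ⟨c, hc, -⟩ := exists_const_of_quasiperiodic hτ hrem norm_one norm_one q1 q2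
  have hθ : ∀ x, theta x τ = c * thetaProd x τ := by
    intro x
    by_cases hx : IsPeriod τ x
    · rw [theta_eq_zero_of_isPeriod hx, thetaProd_eq_zero_of_isPeriod hτ hx, mul_zero]
    · rw [← hc x (hana x hx).continuousAt,
        div_mul_cancel₀ _ fun h => hx (isPeriod_of_thetaProd_eq_zero hτ h)]
  refine ⟨c, ?_, hθ⟩
  rintro rfl
  obtain ⟨z, hz⟩ := exists_jacobiTheta₂_ne_zero hτ
  have := hθ (z - 1 / 2 - τ / 2)
  rw [zero_mul, theta_eq_jacobiTheta₂, mul_eq_zero, or_iff_right (e_ne_zero _)] at this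
  exact hz (by rw [← this]; congr 1; ring)

theorem theta_ne_zero {τ : ℂ} (hτ : 0 < τ.im) {x : ℂ} (hx : ¬ IsPeriod τ x) : theta x τ ≠ 0 := by
  obtain ⟨c, hc, h⟩ := exists_theta_eq_thetaProd hτ
  rw [h]
  exact mul_ne_zero hc fun h => hx (isPeriod_of_thetaProd_eq_zero hτ h)

theorem deriv_theta_zero_ne_zero {τ : ℂ} (hτ : 0 < τ.im) : deriv (fun x => theta x τ) 0 ≠ 0 := by
  obtain ⟨c, hc, h⟩ := exists_theta_eq_thetaProd hτ
  simp only [h]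
  rw [deriv_const_mul _ (differentiable_thetaProd hτ 0)]
  exact mul_ne_zero hc (deriv_thetaProd_zero hτ)

/-! ### The Kronecker function on the torus -/

/-- The group `(ℝ/ℤ)²`, on which the Kronecker function depends through its vector argument. -/
abbrev Torus : Type := Fin 2 → UnitAddCircle

/-- The class modulo `ℤ²` of a real vector. -/
def toTorus (v : Fin 2 → ℝ) : Torus := fun i => (v i : UnitAddCircle)

theorem toTorus_add (v w : Fin 2 → ℝ) : toTorus (v + w) = toTorus v + toTorus w := by
  funext i; simp [toTorus]

theorem toTorus_sub (v w : Fin 2 → ℝ) : toTorus (v - w) = toTorus v - toTorus w := by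
  funext i; simp [toTorus]

theorem toTorus_neg (v : Fin 2 → ℝ) : toTorus (-v) = -toTorus v := by
  funext i; simp [toTorus]

theorem toTorus_int_smul (n : ℤ) (v : Fin 2 → ℝ) : toTorus ((n : ℝ) • v) = n • toTorus v := by
  funext i
  simp only [toTorus, Pi.smul_apply, smul_eq_mul, ← zsmul_eq_mul]
  exact AddCircle.coe_zsmul _

theorem coe_unitAddCircle_eq_zero {x : ℝ} : (x : UnitAddCircle) = 0 ↔ ∃ n : ℤ, x = n := by
  rw [AddCircle.coe_eq_zero_iff]
  simp [eq_comm]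

theorem toTorus_eq_zero {v : Fin 2 → ℝ} : toTorus v = 0 ↔ v ∈ intLattice := by
  rw [funext_iff]
  exact forall_congr' fun i => coe_unitAddCircle_eq_zero

theorem exists_toTorus (s : Torus) : ∃ v, toTorus v = s := by
  choose v hv using fun i => QuotientAddGroup.mk_surjective (s i)
  exact ⟨v, funext hv⟩

theorem toTorus_eq_iff {v w : Fin 2 → ℝ} :
    toTorus v = toTorus w ↔ ∃ m k : ℤ, v = ![w 0 + m, w 1 + k] := by
  rw [← sub_eq_zero, ← toTorus_sub, toTorus_eq_zero]
  constructor
  · intro h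
    obtain ⟨m, hm⟩ := h 0
    obtain ⟨k, hk⟩ := h 1
    refine ⟨m, k, ?_⟩
    ext i
    fin_cases i
    · simp [← hm]
    · simp [← hk]
  · rintro ⟨m, k, rfl⟩ i
    fin_cases i
    · exact ⟨m, by simp⟩
    · exact ⟨k, by simp⟩

/-- The character `mτ + k ↦ e(m s₀ + k s₁)` of the period lattice attached to `s`, as a function
of `m` and `k`. -/
noncomputable def char (s : Torus) (m k : ℤ) : ℂ := (AddCircle.toCircle (m • s 0 + k • s 1) : ℂ)

theorem coe_toCircle (x : ℝ) : ((AddCircle.toCircle (x : UnitAddCircle) : Circle) : ℂ) = e x := by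
  rw [AddCircle.toCircle_apply_mk, Circle.coe_exp, e]
  congr 1
  push_cast
  ring

theorem char_toTorus (v : Fin 2 → ℝ) (m k : ℤ) : char (toTorus v) m k = e (m * v 0 + k * v 1) := by
  have h : m • toTorus v 0 + k • toTorus v 1 = ((m * v 0 + k * v 1 : ℝ) : UnitAddCircle) := by
    simp only [toTorus, ← zsmul_eq_mul]
    rfl
  rw [char, h, coe_toCircle]
  push_cast
  rfl

theorem char_ne_zero (s : Torus) (m k : ℤ) : char s m k ≠ 0 := Circle.coe_ne_zero _

theorem norm_char (s : Torus) (m k : ℤ) : ‖char s m k‖ = 1 := Circle.norm_coe _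

theorem char_add (s t : Torus) (m k : ℤ) : char (s + t) m k = char s m k * char t m k := by
  rw [char, char, char, ← Circle.coe_mul, ← AddCircle.toCircle_add]
  congr 2
  simp only [Pi.add_apply, smul_add]
  abel

theorem char_neg (s : Torus) (m k : ℤ) : char (-s) m k = (char s m k)⁻¹ := by
  rw [char, char, ← Circle.coe_inv, ← AddCircle.toCircle_neg]
  congr 2
  simp only [Pi.neg_apply, smul_neg]
  abel

theorem char_sub (s t : Torus) (m k : ℤ) : char (s - t) m k = char s m k / char t m k := by
  rw [sub_eq_add_neg, char_add, char_neg, div_eq_mul_inv]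

theorem char_zsmul (n : ℤ) (s : Torus) (m k : ℤ) : char (n • s) m k = char s (n * m) (n * k) := by
  rw [char, char]
  congr 2
  simp only [Pi.smul_apply, smul_smul, mul_comm]

theorem eq_zero_of_char_eq_one {s : Torus} (h0 : char s 1 0 = 1) (h1 : char s 0 1 = 1) : s = 0 := by
  have key : ∀ x : UnitAddCircle, ((AddCircle.toCircle x : Circle) : ℂ) = 1 → x = 0 := fun x hx =>
    AddCircle.injective_toCircle one_ne_zero (by
      rw [AddCircle.toCircle_zero]
      exact Subtype.ext hx)
  rw [char, one_zsmul, zero_zsmul, add_zero] at h0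
  rw [char, one_zsmul, zero_zsmul, zero_add] at h1
  funext i
  fin_cases i
  · exact key _ h0
  · exact key _ h1

/-- A nonzero point of the torus gives a point `-x' + xτ` outside the period lattice. -/
theorem isPeriod_iff_mem_intLattice {τ : ℂ} (hτ : 0 < τ.im) (v : Fin 2 → ℝ) :
    IsPeriod τ (-(v 0 : ℂ) + v 1 * τ) ↔ v ∈ intLattice := by
  constructor
  · rintro ⟨m, k, h⟩
    have him := congrArg Complex.im h
    have hre := congrArg Complex.re h
    simp at him hre
    have h1 : v 1 = m := him.resolve_right hτ.ne'
    rw [h1] at hre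
    intro i
    fin_cases i
    · exact ⟨-k, by push_cast; show v 0 = _; linarith⟩
    · exact ⟨m, h1⟩
  · intro h
    obtain ⟨m, hm⟩ := h 0
    obtain ⟨k, hk⟩ := h 1
    exact ⟨k, -m, by rw [hm, hk]; push_cast; ring⟩

theorem F_periodic_fst (y : ℝ) (X τ : ℂ) : Function.Periodic (fun x : ℝ => F ![x, y] X τ) 1 := by
  intro x
  have h1 (X : ℂ) : theta (-((x + 1 : ℝ) : ℂ) + y * τ + X) τ = -theta (-(x : ℂ) + y * τ + X) τ := by
    rw [← neg_neg (theta (-((x + 1 : ℝ) : ℂ) + y * τ + X) τ), ← theta_add_one]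
    congr 2
    push_cast
    ring
  have h2 := h1 0
  simp only [add_zero] at h2
  simp only [F, Matrix.cons_val_zero, Matrix.cons_val_one, h1, h2, mul_neg, neg_mul,
    neg_div_neg_eq]

theorem F_periodic_snd (x : ℝ) (X τ : ℂ) : Function.Periodic (fun y : ℝ => F ![x, y] X τ) 1 := by
  intro y
  have h1 (X : ℂ) : theta (-(x : ℂ) + (y + 1 : ℝ) * τ + X) τ =
      -e (-τ / 2 - (-(x : ℂ) + y * τ)) * e (-X) * theta (-(x : ℂ) + y * τ + X) τ := by
    rw [neg_mul, ← e_add, show -τ / 2 - (-(x : ℂ) + y * τ) + -X =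
      -τ / 2 - (-(x : ℂ) + y * τ + X) by ring, ← theta_add_tau]
    congr 1
    push_cast
    ring
  have h2 := h1 0
  simp only [add_zero, neg_zero, e_zero, mul_one] at h2
  have h3 : e (((y + 1 : ℝ) : ℂ) * X) = e (y * X) * e X := by
    rw [← e_add]; congr 1; push_cast; ring
  simp only [F, Matrix.cons_val_zero, Matrix.cons_val_one, h1, h2, h3]
  have h4 : e (-X) = (e X)⁻¹ := e_neg X
  have h5 := e_ne_zero X
  have h6 := e_ne_zero (-τ / 2 - (-(x : ℂ) + y * τ))
  rw [h4]
  generalize e (-τ / 2 - (-(x : ℂ) + y * τ)) = w at h6 ⊢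
  field_simp

theorem F_eq_of_toTorus_eq {v w : Fin 2 → ℝ} (h : toTorus v = toTorus w) (X τ : ℂ) :
    F v X τ = F w X τ := by
  obtain ⟨m, k, rfl⟩ := toTorus_eq_iff.1 h
  have h1 := (F_periodic_fst (w 1 + k) X τ).int_mul m (w 0)
  have h2 := (F_periodic_snd (w 0) X τ).int_mul k (w 1)
  simp only [mul_one] at h1 h2
  rw [h1, h2]
  congr 1
  ext i
  fin_cases i <;> rfl

/-- The function `F(v; X; τ)` for a class `v` modulo `ℤ²`, computed at a chosen representative; by
`F_eq_of_toTorus_eq` the choice does not matter. -/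
noncomputable def kron (τ : ℂ) (s : Torus) (X : ℂ) : ℂ := F (exists_toTorus s).choose X τ

theorem kron_toTorus (τ : ℂ) (v : Fin 2 → ℝ) (X : ℂ) : kron τ (toTorus v) X = F v X τ :=
  F_eq_of_toTorus_eq (exists_toTorus (toTorus v)).choose_spec X τ

theorem F_neg (v : Fin 2 → ℝ) (X τ : ℂ) : F (-v) (-X) τ = -F v X τ := by
  have h1 (X : ℂ) : theta (-(-v 0 : ℂ) + -v 1 * τ + -X) τ =
      -theta (-(v 0 : ℂ) + v 1 * τ + X) τ := by
    rw [← theta_neg]; congr 1; ring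
  have h2 := h1 0
  simp only [neg_zero, add_zero] at h2
  simp only [F, Pi.neg_apply, Complex.ofReal_neg, h1, h2, theta_neg, neg_mul_neg]
  ring

theorem kron_neg (τ : ℂ) (s : Torus) (X : ℂ) : kron τ (-s) (-X) = -kron τ s X := by
  obtain ⟨v, rfl⟩ := exists_toTorus s
  rw [← toTorus_neg, kron_toTorus, kron_toTorus, F_neg]

theorem F_add_one (v : Fin 2 → ℝ) (X τ : ℂ) : F v (X + 1) τ = e (v 1) * F v X τ := by
  simp only [F, ← add_assoc, theta_add_one, mul_neg, neg_div_neg_eq, mul_add, mul_one, e_add]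
  ring

theorem F_add_tau (v : Fin 2 → ℝ) (X τ : ℂ) : F v (X + τ) τ = e (v 0) * F v X τ := by
  have h : e (v 1 * (X + τ)) * e (-τ / 2 - (-(v 0 : ℂ) + v 1 * τ + X)) =
      e (v 0) * e (v 1 * X) * e (-τ / 2 - X) := by
    rw [← e_add, ← e_add, ← e_add]; congr 1; ring
  have h2 := e_ne_zero (-τ / 2 - X)
  have h3 : e (v 1 * (X + τ)) * e (-τ / 2 - (-(v 0 : ℂ) + v 1 * τ + X)) / e (-τ / 2 - X) =
      e (v 0) * e (v 1 * X) := by rw [h, mul_div_cancel_right₀ _ h2]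
  simp only [F, ← add_assoc, theta_add_tau]
  rw [← mul_assoc (e (v 0)), ← h3]
  simp only [div_eq_mul_inv, mul_inv, inv_neg]
  ring

theorem map_add_int_mul {f : ℂ → ℂ} {w a : ℂ} (ha : a ≠ 0) (h : ∀ x, f (x + w) = a * f x) (k : ℤ)
    (x : ℂ) : f (x + k * w) = a ^ k * f x := by
  induction k using Int.induction_on generalizing x with
  | zero => simp
  | succ k ih =>
    rw [show x + ((k + 1 : ℤ) : ℂ) * w = x + w + (k : ℤ) * w by push_cast; ring, ih, h,
      zpow_add_one₀ ha, mul_assoc]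
  | pred k ih =>
    have := h (x - w)
    rw [sub_add_cancel] at this
    rw [show x + ((-(k : ℤ) - 1 : ℤ) : ℂ) * w = x - w + ((-(k : ℤ) : ℤ) : ℂ) * w by push_cast; ring,
      ih, this, zpow_sub_one₀ ha, mul_assoc, inv_mul_cancel_left₀ ha]

theorem kron_add_period (τ : ℂ) (s : Torus) (X : ℂ) (m k : ℤ) :
    kron τ s (X + (m * τ + k)) = char s m k * kron τ s X := by
  obtain ⟨v, rfl⟩ := exists_toTorus s
  simp only [kron_toTorus, char_toTorus]
  have h1 := map_add_int_mul (f := fun X => F v X τ) (e_ne_zero _) (fun X => F_add_one v X τ) k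
    (X + m * τ)
  have h2 := map_add_int_mul (f := fun X => F v X τ) (e_ne_zero _) (fun X => F_add_tau v X τ) m X
  simp only [mul_one] at h1 h2
  rw [← add_assoc, h1, h2, ← mul_assoc, ← e_int_mul, ← e_int_mul, ← e_add, add_comm]

theorem kron_sub_period (τ : ℂ) (s : Torus) (X : ℂ) (m k : ℤ) :
    kron τ s X = char s m k * kron τ s (X - (m * τ + k)) := by
  rw [← kron_add_period, sub_add_cancel]

theorem differentiable_theta_const_add {τ : ℂ} (hτ : 0 < τ.im) (u : ℂ) :
    Differentiable ℂ fun X => theta (u + X) τ :=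
  (differentiable_theta hτ).comp ((differentiable_id (𝕜 := ℂ)).const_add u)

theorem meromorphic_kron {τ : ℂ} (hτ : 0 < τ.im) (s : Torus) : Meromorphic (kron τ s) := by
  obtain ⟨v, rfl⟩ := exists_toTorus s
  rw [funext (kron_toTorus τ v)]
  have h1 := differentiable_theta_const_add hτ (-(v 0 : ℂ) + v 1 * τ)
  have h2 := differentiable_theta hτ
  have h3 : Differentiable ℂ fun X : ℂ => e (v 1 * X) := by fun_prop
  intro X
  exact (h3.analyticAt X).meromorphicAt.mul (((h1.const_mul _).analyticAt X).meromorphicAt.div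
    ((h2.const_mul _).analyticAt X).meromorphicAt)

theorem analyticAt_kron {τ : ℂ} (hτ : 0 < τ.im) {s : Torus} (hs : s ≠ 0) {X : ℂ}
    (hX : ¬ IsPeriod τ X) : AnalyticAt ℂ (kron τ s) X := by
  obtain ⟨v, rfl⟩ := exists_toTorus s
  rw [funext (kron_toTorus τ v)]
  have h1 := differentiable_theta_const_add hτ (-(v 0 : ℂ) + v 1 * τ)
  have h2 := differentiable_theta hτ
  have h3 : Differentiable ℂ fun X : ℂ => e (v 1 * X) := by fun_prop
  have h4 : theta (-(v 0 : ℂ) + v 1 * τ) τ ≠ 0 := theta_ne_zero hτ fun h =>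
    hs (toTorus_eq_zero.2 ((isPeriod_iff_mem_intLattice hτ v).1 h))
  exact (h3.analyticAt X).mul (((h1.const_mul _).analyticAt X).div ((h2.const_mul _).analyticAt X)
    (mul_ne_zero h4 (theta_ne_zero hτ hX)))

/-- The Kronecker function has a simple pole at the origin, with residue `1`. -/
theorem tendsto_mul_kron_zero {τ : ℂ} (hτ : 0 < τ.im) {s : Torus} (hs : s ≠ 0) :
    Tendsto (fun z => z * kron τ s z) (𝓝[≠] 0) (𝓝 1) := by
  obtain ⟨v, rfl⟩ := exists_toTorus s
  simp only [kron_toTorus]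
  have h4 : theta (-(v 0 : ℂ) + v 1 * τ) τ ≠ 0 := theta_ne_zero hτ fun h =>
    hs (toTorus_eq_zero.2 ((isPeriod_iff_mem_intLattice hτ v).1 h))
  have h5 := deriv_theta_zero_ne_zero hτ
  have l1 := tendsto_id_div_of_deriv_ne_zero (differentiable_theta hτ 0) (theta_zero τ) h5
  have h1 := differentiable_theta_const_add hτ (-(v 0 : ℂ) + v 1 * τ)
  have h3 : Differentiable ℂ fun X : ℂ => e (v 1 * X) := by fun_prop
  have l2 := ((h3.mul h1) 0).continuousAt.tendsto.mono_left (nhdsWithin_le_nhds (s := {0}ᶜ))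
  have l3 := (l2.mul l1).mul_const
    (deriv (fun t => theta t τ) 0 / theta (-(v 0 : ℂ) + v 1 * τ) τ)
  simp only [Pi.mul_apply, mul_zero, e_zero, add_zero, one_mul] at l3
  rw [show theta (-(v 0 : ℂ) + v 1 * τ) τ * (deriv (fun t => theta t τ) 0)⁻¹ *
    (deriv (fun t => theta t τ) 0 / theta (-(v 0 : ℂ) + v 1 * τ) τ) = 1 by field_simp] at l3
  refine l3.congr fun z => ?_
  simp only [F, div_eq_mul_inv, mul_inv]
  ring

/-- The residue of the Kronecker function at the period `mτ + k`. -/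
theorem tendsto_sub_mul_kron {τ : ℂ} (hτ : 0 < τ.im) {s : Torus} (hs : s ≠ 0) (m k : ℤ) :
    Tendsto (fun z => (z - (m * τ + k)) * kron τ s z) (𝓝[≠] (m * τ + k)) (𝓝 (char s m k)) := by
  have h := tendsto_sub_nhdsNE (m * τ + k) (m * τ + k)
  rw [sub_self] at h
  have h1 := ((tendsto_mul_kron_zero hτ hs).comp h).const_mul (char s m k)
  rw [mul_one] at h1
  refine h1.congr fun z => ?_
  rw [kron_sub_period τ s z m k, Function.comp]
  ring

/-! ### Fay's identity -/

theorem tendsto_sub_mul_of_continuousAt {g : ℂ → ℂ} {x : ℂ} (hg : ContinuousAt g x) :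
    Tendsto (fun z => (z - x) * g z) (𝓝[≠] x) (𝓝 0) := by
  have h : ContinuousAt (fun z => (z - x) * g z) x := by fun_prop
  have := h.tendsto.mono_left (nhdsWithin_le_nhds (s := {x}ᶜ))
  simpa using this

theorem tendsto_add_nhdsNE (x y : ℂ) : Tendsto (fun z => z + y) (𝓝[≠] x) (𝓝[≠] (x + y)) := by
  simpa using tendsto_sub_nhdsNE x (-y)

/-- Fay's trisecant identity. In the variable `A` both sides have the multipliers of the nontrivial
character `char p` and the same residues. -/
theorem fay {τ : ℂ} (hτ : 0 < τ.im) {p q : Torus} (hp : p ≠ 0) (hq : q ≠ 0) (hpq : p ≠ q)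
    {A B : ℂ} (hA : ¬ IsPeriod τ A) (hB : ¬ IsPeriod τ B) (hAB : ¬ IsPeriod τ (A + B)) :
    kron τ p A * kron τ q B =
      kron τ (q - p) B * kron τ p (A + B) + kron τ (p - q) A * kron τ q (A + B) := by
  have hpq' : p - q ≠ 0 := sub_ne_zero.2 hpq
  set f : ℂ → ℂ := fun X => kron τ p X * kron τ q B -
    (kron τ (q - p) B * kron τ p (X + B) + kron τ (p - q) X * kron τ q (X + B)) with hf
  have hsub : ∀ X, IsPeriod τ X → ¬ IsPeriod τ (X + B) := fun X h h' => hB (by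
    have := h'.add h.neg
    rwa [add_neg_cancel_comm] at this)
  have aadd : ∀ {s : Torus} (_ : s ≠ 0) {X : ℂ} (_ : ¬ IsPeriod τ (X + B)),
      AnalyticAt ℂ (fun X => kron τ s (X + B)) X := fun hs X hX =>
    (analyticAt_kron hτ hs hX).comp_of_eq (f := fun X => X + B) (by fun_prop) rfl
  have madd : ∀ (s : Torus) (X : ℂ), MeromorphicAt (fun X => kron τ s (X + B)) X := fun s X =>
    (meromorphic_kron hτ s (X + B)).comp_analyticAt (g := fun X => X + B) (by fun_prop)
  have hana : ∀ X, ¬ IsPeriod τ X → ¬ IsPeriod τ (X + B) → AnalyticAt ℂ f X := fun X h1 h2 =>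
    ((analyticAt_kron hτ hp h1).mul analyticAt_const).sub
      ((analyticAt_const.mul (aadd hp h2)).add ((analyticAt_kron hτ hpq' h1).mul (aadd hq h2)))
  have hmer : Meromorphic f := fun X =>
    ((meromorphic_kron hτ p X).mul (MeromorphicAt.const _ X)).sub
      (((MeromorphicAt.const _ X).mul (madd p X)).add ((meromorphic_kron hτ _ X).mul (madd q X)))
  have hquasi : ∀ (m k : ℤ) (X : ℂ), f (X + (m * τ + k)) = char p m k * f X := by
    intro m k X
    simp only [hf, add_right_comm X _ B, kron_add_period]
    rw [char_sub]
    field_simp [char_ne_zero q m k]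
  have hrem : ∀ X, Removable f X := by
    intro X
    by_cases h1 : IsPeriod τ X
    · -- the residues of the first and the third term cancel
      have h2 := hsub X h1
      refine removable_of_tendsto (hmer X) ?_
      obtain ⟨m, k, rfl⟩ := h1
      have l1 := (tendsto_sub_mul_kron hτ hp m k).mul_const (kron τ q B)
      have l2 := tendsto_sub_mul_of_continuousAt (aadd hp h2).continuousAt
      have l3 := (tendsto_sub_mul_kron hτ hpq' m k).mul
        ((aadd hq h2).continuousAt.tendsto.mono_left nhdsWithin_le_nhds)
      have l4 := l1.sub ((l2.const_mul (kron τ (q - p) B)).add l3)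
      rw [add_comm _ B, kron_add_period, char_sub, mul_zero, zero_add, ← mul_assoc,
        div_mul_cancel₀ _ (char_ne_zero q m k), sub_self] at l4
      refine l4.congr fun z => ?_
      simp only [hf]
      ring
    · by_cases h2 : IsPeriod τ (X + B)
      · -- the residues of the second and the third term cancel
        refine removable_of_tendsto (hmer X) ?_
        obtain ⟨m, k, h2⟩ := h2
        have t := tendsto_add_nhdsNE X B
        rw [h2] at t
        have l1 := tendsto_sub_mul_of_continuousAt (analyticAt_kron hτ hp h1).continuousAt
        have l2 := (tendsto_sub_mul_kron hτ hp m k).comp t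
        have l3 := ((tendsto_sub_mul_kron hτ hq m k).comp t).mul
          ((analyticAt_kron hτ hpq' h1).continuousAt.tendsto.mono_left nhdsWithin_le_nhds)
        have l4 := (l1.mul_const (kron τ q B)).sub ((l2.const_mul (kron τ (q - p) B)).add l3)
        have e1 : kron τ (p - q) X = char (p - q) m k * -kron τ (q - p) B := by
          rw [← kron_neg, neg_sub, ← kron_add_period, ← h2, add_comm X B, neg_add_cancel_left]
        rw [e1, char_sub, show 0 * kron τ q B - (kron τ (q - p) B * char p m k +
          char q m k * (char p m k / char q m k * -kron τ (q - p) B)) = 0 by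
            field_simp [char_ne_zero q m k]; ring] at l4
        refine l4.congr fun z => ?_
        simp only [hf, Function.comp, ← h2]
        ring
      · exact removable_of_analyticAt (hana X h1 h2)
  obtain ⟨c, hc, hc0⟩ := exists_const_of_quasiperiodic hτ hrem (norm_char p 0 1) (norm_char p 1 0)
    (fun X => by simpa using hquasi 0 1 X) (fun X => by simpa using hquasi 1 0 X)
  have h0 : c = 0 := hc0 (by
    by_contra! h
    exact hp (eq_zero_of_char_eq_one h.2 h.1))
  have := hc A (hana A hA hAB).continuousAt
  rw [h0] at this
  exact sub_eq_zero.1 this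

/-! ### The distribution relation -/

open scoped Classical in
/-- The finite set of points `p` of the torus with `n • p = s`, for `n ≠ 0`; it is empty for
`n = 0`, where the equation may have infinitely many solutions. -/
noncomputable def fiber (n : ℤ) (s : Torus) : Finset Torus :=
  (Finset.range n.natAbs ×ˢ Finset.range n.natAbs).image fun j =>
    toTorus ((1 / (n : ℝ)) • (![(j.1 : ℝ), (j.2 : ℝ)] + (exists_toTorus s).choose))

theorem injOn_toTorus_div {n : ℤ} (hn : n ≠ 0) (v : Fin 2 → ℝ) :
    Set.InjOn (fun j : ℕ × ℕ => toTorus ((1 / (n : ℝ)) • (![(j.1 : ℝ), (j.2 : ℝ)] + v)))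
      (Finset.range n.natAbs ×ˢ Finset.range n.natAbs : Finset (ℕ × ℕ)) := by
  have hn' : (n : ℝ) ≠ 0 := by exact_mod_cast hn
  have key : ∀ (a b : ℕ), a < n.natAbs → b < n.natAbs → ∀ w : ℝ,
      (∃ k : ℤ, 1 / (n : ℝ) * (a + w) - 1 / (n : ℝ) * (b + w) = k) → a = b := by
    rintro a b ha hb w ⟨k, hk⟩
    field_simp at hk
    have h1 : (a : ℤ) - b = n * k := by
      have : (a : ℝ) - b = n * k := by linarith
      exact_mod_cast this
    have h2 : n ∣ (a : ℤ) - b := ⟨k, h1⟩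
    have h3 : (a : ℤ) - b = 0 := Int.eq_zero_of_abs_lt_dvd (Int.natAbs_dvd.2 h2) (by
      rw [abs_lt]; omega)
    omega
  rintro ⟨a, b⟩ h ⟨a', b'⟩ h' hab
  simp only [Finset.coe_product, Finset.coe_range, Set.mem_prod, Set.mem_Iio] at h h'
  rw [← sub_eq_zero, ← toTorus_sub, toTorus_eq_zero] at hab
  have h0 := key a a' h.1 h'.1 _ (by simpa using hab 0)
  have h1 := key b b' h.2 h'.2 _ (by simpa using hab 1)
  rw [h0, h1]

theorem mem_image_toTorus_div {n : ℤ} (hn : n ≠ 0) (v : Fin 2 → ℝ) {p : Torus} :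
    (∃ j ∈ Finset.range n.natAbs ×ˢ Finset.range n.natAbs,
      toTorus ((1 / (n : ℝ)) • (![(j.1 : ℝ), (j.2 : ℝ)] + v)) = p) ↔ n • p = toTorus v := by
  have hn' : (n : ℝ) ≠ 0 := by exact_mod_cast hn
  constructor
  · rintro ⟨j, -, rfl⟩
    rw [← toTorus_int_smul, smul_smul, mul_one_div_cancel hn', one_smul, toTorus_add,
      add_eq_right, toTorus_eq_zero]
    intro i
    fin_cases i
    · exact ⟨j.1, by simp⟩
    · exact ⟨j.2, by simp⟩
  · obtain ⟨w, rfl⟩ := exists_toTorus p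
    intro h
    rw [← toTorus_int_smul, ← sub_eq_zero, ← toTorus_sub, toTorus_eq_zero] at h
    choose a ha using h
    have hr : ∀ i, (((a i % n).toNat : ℕ) : ℤ) = a i % n := fun i =>
      Int.toNat_of_nonneg (Int.emod_nonneg _ hn)
    have hr' : ∀ i, (((a i % n).toNat : ℕ) : ℝ) = a i - n * (a i / n : ℤ) := fun i => by
      have h1 : (((a i % n).toNat : ℕ) : ℤ) = a i - n * (a i / n) := by
        rw [hr, Int.emod_def]
      exact_mod_cast h1
    have hlt : ∀ i, (a i % n).toNat < n.natAbs := fun i => by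
      have := Int.emod_lt_abs (a i) hn
      rw [← hr, Int.abs_eq_natAbs] at this
      exact_mod_cast this
    refine ⟨((a 0 % n).toNat, (a 1 % n).toNat), by simp [hlt], ?_⟩
    rw [← sub_eq_zero, ← toTorus_sub, toTorus_eq_zero]
    have hq : ∀ i, 1 / (n : ℝ) * (((a i % n).toNat : ℕ) + v i) - w i = ((-(a i / n) : ℤ) : ℝ) := by
      intro i
      have := ha i
      simp only [Pi.sub_apply, Pi.smul_apply, smul_eq_mul] at this
      rw [hr']
      push_cast
      field_simp
      linarith
    intro i
    fin_cases i
    · exact ⟨_, hq 0⟩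
    · exact ⟨_, hq 1⟩

theorem mem_fiber {n : ℤ} (hn : n ≠ 0) {s p : Torus} : p ∈ fiber n s ↔ n • p = s := by
  rw [fiber, Finset.mem_image, mem_image_toTorus_div hn, (exists_toTorus s).choose_spec]

theorem card_fiber {n : ℤ} (hn : n ≠ 0) (s : Torus) : ((fiber n s).card : ℂ) = n ^ 2 := by
  rw [fiber, Finset.card_image_of_injOn (injOn_toTorus_div hn _), Finset.card_product,
    Finset.card_range]
  have : ((n.natAbs * n.natAbs : ℕ) : ℤ) = n ^ 2 := by
    rw [Nat.cast_mul, Int.natAbs_mul_self', sq]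
  rw [← Int.cast_natCast, this, Int.cast_pow]

theorem sum_fiber_toTorus {n : ℤ} (hn : n ≠ 0) (v : Fin 2 → ℝ) (g : Torus → ℂ) :
    ∑ p ∈ fiber n (toTorus v), g p =
      ∑ j' ∈ Finset.range n.natAbs, ∑ j ∈ Finset.range n.natAbs,
        g (toTorus ((1 / (n : ℝ)) • (![(j' : ℝ), (j : ℝ)] + v))) := by
  classical
  have h : fiber n (toTorus v) = (Finset.range n.natAbs ×ˢ Finset.range n.natAbs).image fun j =>
      toTorus ((1 / (n : ℝ)) • (![(j.1 : ℝ), (j.2 : ℝ)] + v)) := by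
    ext p
    rw [mem_fiber hn, Finset.mem_image, mem_image_toTorus_div hn]
  rw [h, Finset.sum_image (injOn_toTorus_div hn v), Finset.sum_product]

/-- Orthogonality of characters. -/
theorem sum_fiber_char {n : ℤ} (hn : n ≠ 0) (s : Torus) {m k : ℤ} (h : ¬ (n ∣ m ∧ n ∣ k)) :
    ∑ p ∈ fiber n s, char p m k = 0 := by
  have hn' : (n : ℂ) ≠ 0 := by exact_mod_cast hn
  obtain ⟨t, ht, htc⟩ : ∃ t : Torus, n • t = 0 ∧ char t m k ≠ 1 := by
    have hdvd : ∀ a : ℤ, (∃ b : ℤ, (a : ℂ) * (1 / n) = b) → n ∣ a := by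
      rintro a ⟨b, hb⟩
      refine ⟨b, ?_⟩
      field_simp at hb
      exact_mod_cast hb
    have hnr : (n : ℝ) ≠ 0 := by exact_mod_cast hn
    rcases not_and_or.1 h with h | h
    · refine ⟨toTorus ![1 / n, 0], ?_, fun hc => h (hdvd m ?_)⟩
      · rw [← toTorus_int_smul, toTorus_eq_zero]
        intro i
        fin_cases i
        · exact ⟨1, by simp [hnr]⟩
        · exact ⟨0, by simp⟩
      · rw [char_toTorus, e_eq_one_iff] at hc
        simpa using hc
    · refine ⟨toTorus ![0, 1 / n], ?_, fun hc => h (hdvd k ?_)⟩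
      · rw [← toTorus_int_smul, toTorus_eq_zero]
        intro i
        fin_cases i
        · exact ⟨0, by simp⟩
        · exact ⟨1, by simp [hnr]⟩
      · rw [char_toTorus, e_eq_one_iff] at hc
        simpa using hc
  -- translating the fiber by the torsion point `t` multiplies the sum by `char t m k ≠ 1`
  have hsum : ∑ p ∈ fiber n s, char p m k = ∑ p ∈ fiber n s, char p m k * char t m k := by
    symm
    refine Finset.sum_equiv (Equiv.addRight t) (fun p => ?_) fun p _ => ?_
    · rw [mem_fiber hn, mem_fiber hn, Equiv.coe_addRight, smul_add, ht, add_zero]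
    · rw [Equiv.coe_addRight, char_add]
  rw [← Finset.sum_mul] at hsum
  by_contra h0
  exact htc (mul_left_cancel₀ h0 (by rw [← hsum, mul_one]))

theorem tendsto_mul_nhdsNE {c : ℂ} (hc : c ≠ 0) (x : ℂ) :
    Tendsto (fun z => c * z) (𝓝[≠] x) (𝓝[≠] (c * x)) :=
  tendsto_nhdsWithin_iff.2 ⟨((continuous_const_mul c).tendsto x).mono_left nhdsWithin_le_nhds,
    eventually_mem_nhdsWithin.mono fun z hz => by simpa [hc] using hz⟩

/-- The distribution relation: summing over the `n`-division points of `s` restricts the Kronecker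
series to the periods divisible by `n`. -/
theorem sum_fiber_kron {τ : ℂ} (hτ : 0 < τ.im) {n : ℤ} (hn : n ≠ 0) {s : Torus} (hs : s ≠ 0)
    {L : ℂ} (hL : ¬ IsPeriod τ (n * L)) :
    ∑ p ∈ fiber n s, kron τ p (n * L) = n * kron τ s L := by
  have hn' : (n : ℂ) ≠ 0 := by exact_mod_cast hn
  have hp : ∀ p ∈ fiber n s, p ≠ 0 := by
    rintro p h rfl
    rw [mem_fiber hn, smul_zero] at h
    exact hs h.symm
  set f : ℂ → ℂ := fun X => ∑ p ∈ fiber n s, kron τ p (n * X) - n * kron τ s X with hf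
  have hana : ∀ X, ¬ IsPeriod τ (n * X) → AnalyticAt ℂ f X := fun X h =>
    (Finset.analyticAt_fun_sum (𝕜 := ℂ) (f := fun p X => kron τ p (n * X)) _ fun p hp' =>
      (analyticAt_kron hτ (hp p hp') h).comp_of_eq (f := fun X : ℂ => n * X) (by fun_prop) rfl).sub
      (analyticAt_const.mul (analyticAt_kron hτ hs fun h' => h (h'.int_mul n)))
  have hmer : Meromorphic f := fun X =>
    (MeromorphicAt.fun_sum fun p _ =>
      (meromorphic_kron hτ p (n * X)).comp_analyticAt (g := fun X : ℂ => n * X) (by fun_prop)).sub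
      ((MeromorphicAt.const _ X).mul (meromorphic_kron hτ s X))
  have hquasi : ∀ (m k : ℤ) (X : ℂ), f (X + (m * τ + k)) = char s m k * f X := by
    intro m k X
    have : ∀ p ∈ fiber n s, kron τ p (n * (X + (m * τ + k))) = char s m k * kron τ p (n * X) := by
      intro p hp'
      rw [← (mem_fiber hn).1 hp', char_zsmul, ← kron_add_period]
      congr 1
      push_cast
      ring
    simp only [hf]
    rw [Finset.sum_congr rfl this, ← Finset.mul_sum, kron_add_period]
    ring
  have hrem : ∀ X, Removable f X := by
    intro X
    by_cases h1 : IsPeriod τ (n * X)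
    · refine removable_of_tendsto (hmer X) ?_
      have lim : ∀ m k : ℤ, n * X = m * τ + k → ∀ p ∈ fiber n s,
          Tendsto (fun z => (z - X) * kron τ p (n * z)) (𝓝[≠] X) (𝓝 ((n : ℂ)⁻¹ * char p m k)) := by
        intro m k h p hp'
        have t := tendsto_mul_nhdsNE hn' X
        rw [h] at t
        refine (((tendsto_sub_mul_kron hτ (hp p hp') m k).comp t).const_mul _).congr fun z => ?_
        simp only [Function.comp, ← h]
        field_simp
      have split : ∀ m k : ℤ, n * X = m * τ + k → ∀ r : ℂ,
          Tendsto (fun z => (z - X) * kron τ s z) (𝓝[≠] X) (𝓝 r) →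
          ∑ p ∈ fiber n s, (n : ℂ)⁻¹ * char p m k - n * r = 0 →
          Tendsto (fun z => (z - X) * f z) (𝓝[≠] X) (𝓝 0) := by
        intro m k h r hr h0
        have := (tendsto_finsetSum _ (lim m k h)).sub (hr.const_mul (n : ℂ))
        rw [h0] at this
        refine this.congr fun z => ?_
        simp only [hf, ← Finset.mul_sum]
        ring
      by_cases h2 : IsPeriod τ X
      · -- all `n ^ 2` terms of the sum have the same residue, up to the factor `n⁻¹`
        obtain ⟨m, k, rfl⟩ := h2
        refine split (n * m) (n * k) (by push_cast; ring) _ (tendsto_sub_mul_kron hτ hs m k) ?_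
        have : ∀ p ∈ fiber n s, (n : ℂ)⁻¹ * char p (n * m) (n * k) = (n : ℂ)⁻¹ * char s m k := by
          intro p hp'
          rw [← char_zsmul, (mem_fiber hn).1 hp']
        rw [Finset.sum_congr rfl this, Finset.sum_const, nsmul_eq_mul, card_fiber hn]
        field_simp
        ring
      · -- the residues of the terms of the sum cancel by orthogonality
        obtain ⟨m, k, h⟩ := h1
        refine split m k h 0 (tendsto_sub_mul_of_continuousAt
          (analyticAt_kron hτ hs h2).continuousAt) ?_
        rw [← Finset.mul_sum, sum_fiber_char hn s, mul_zero, mul_zero, sub_zero]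
        rintro ⟨⟨a, rfl⟩, ⟨b, rfl⟩⟩
        refine h2 ⟨a, b, mul_left_cancel₀ hn' (h.trans ?_)⟩
        push_cast
        ring
    · exact removable_of_analyticAt (hana X h1)
  obtain ⟨c, hc, hc0⟩ := exists_const_of_quasiperiodic hτ hrem (norm_char s 0 1) (norm_char s 1 0)
    (fun X => by simpa using hquasi 0 1 X) (fun X => by simpa using hquasi 1 0 X)
  have h0 : c = 0 := hc0 (by
    by_contra! h
    exact hs (eq_zero_of_char_eq_one h.2 h.1))
  have := hc L (hana L hL).continuousAt
  rw [h0] at this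
  exact sub_eq_zero.1 this

/-! ### The cocycle of products of Kronecker functions -/

/-- The determinant of the integer matrix with rows `w₁`, `w₂`. -/
def rowDet (w₁ w₂ : Fin 2 → ℤ) : ℤ := w₁ 0 * w₂ 1 - w₁ 1 * w₂ 0

/-- The equation `w₁ s + w₂ t = μ` for a pair `(s, t)` of points of the torus. -/
def IsSolution (μ : Fin 2 → Torus) (w₁ w₂ : Fin 2 → ℤ) (p : Torus × Torus) : Prop :=
  ∀ i, w₁ i • p.1 + w₂ i • p.2 = μ i

open scoped Classical in
/-- The finite set of solutions `(s, t)` of `w₁ s + w₂ t = μ`, for linearly independent `w₁`, `w₂`.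
By Cramer's rule they are among the `rowDet w₁ w₂`-division points of known vectors. When
`rowDet w₁ w₂ = 0` the set is empty by convention. -/
noncomputable def solutions (μ : Fin 2 → Torus) (w₁ w₂ : Fin 2 → ℤ) : Finset (Torus × Torus) :=
  (fiber (rowDet w₁ w₂) (w₂ 1 • μ 0 - w₂ 0 • μ 1) ×ˢ
    fiber (rowDet w₁ w₂) (w₁ 0 • μ 1 - w₁ 1 • μ 0)).filter (IsSolution μ w₁ w₂)

theorem mem_solutions {μ : Fin 2 → Torus} {w₁ w₂ : Fin 2 → ℤ} (hD : rowDet w₁ w₂ ≠ 0)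
    {p : Torus × Torus} : p ∈ solutions μ w₁ w₂ ↔ IsSolution μ w₁ w₂ p := by
  classical
  rw [solutions, Finset.mem_filter, Finset.mem_product, mem_fiber hD, mem_fiber hD]
  refine ⟨fun h => h.2, fun h => ⟨⟨?_, ?_⟩, h⟩⟩
  · rw [← h 0, ← h 1, rowDet]
    module
  · rw [← h 0, ← h 1, rowDet]
    module

/-- The sum of `F(s; L₁) F(t; L₂)` over the solutions of `w₁ s + w₂ t = μ`, divided by the
determinant. Formally it is the conditionally convergent series
`det(w₁, w₂) ∑ χ(λ) / ((w₁ λ + L₁) (w₂ λ + L₂))` over pairs `λ` of periods. It is `0` when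
`w₁`, `w₂` are linearly dependent, since then the inverse of the determinant is `0`. -/
noncomputable def pairing (τ : ℂ) (μ : Fin 2 → Torus) (w₁ w₂ : Fin 2 → ℤ) (L₁ L₂ : ℂ) : ℂ :=
  (rowDet w₁ w₂ : ℂ)⁻¹ * ∑ p ∈ solutions μ w₁ w₂, kron τ p.1 L₁ * kron τ p.2 L₂

theorem pairing_of_rowDet_eq_zero {τ : ℂ} {μ : Fin 2 → Torus} {w₁ w₂ : Fin 2 → ℤ} {L₁ L₂ : ℂ}
    (h : rowDet w₁ w₂ = 0) : pairing τ μ w₁ w₂ L₁ L₂ = 0 := by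
  simp [pairing, h]

theorem rowDet_swap (w₁ w₂ : Fin 2 → ℤ) : rowDet w₂ w₁ = -rowDet w₁ w₂ := by
  simp only [rowDet]; ring

theorem pairing_swap (τ : ℂ) (μ : Fin 2 → Torus) (w₁ w₂ : Fin 2 → ℤ) (L₁ L₂ : ℂ) :
    pairing τ μ w₂ w₁ L₂ L₁ = -pairing τ μ w₁ w₂ L₁ L₂ := by
  by_cases hD : rowDet w₁ w₂ = 0
  · rw [pairing_of_rowDet_eq_zero hD, pairing_of_rowDet_eq_zero (by rw [rowDet_swap, hD, neg_zero]),
      neg_zero]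
  have hD' : rowDet w₂ w₁ ≠ 0 := by rwa [rowDet_swap, neg_ne_zero]
  rw [pairing, pairing, rowDet_swap w₁ w₂, Int.cast_neg, inv_neg, neg_mul]
  congr 2
  refine Finset.sum_equiv (Equiv.prodComm _ _) (fun p => ?_) fun p _ => mul_comm _ _
  rw [mem_solutions hD', mem_solutions hD]
  exact forall_congr' fun i => by rw [add_comm]; rfl

theorem pairing_neg_left (τ : ℂ) (μ : Fin 2 → Torus) (w₁ w₂ : Fin 2 → ℤ) (L₁ L₂ : ℂ) :
    pairing τ μ (-w₁) w₂ (-L₁) L₂ = pairing τ μ w₁ w₂ L₁ L₂ := by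
  have h : rowDet (-w₁) w₂ = -rowDet w₁ w₂ := by simp only [rowDet, Pi.neg_apply]; ring
  by_cases hD : rowDet w₁ w₂ = 0
  · rw [pairing_of_rowDet_eq_zero hD, pairing_of_rowDet_eq_zero (by rw [h, hD, neg_zero])]
  have hD' : rowDet (-w₁) w₂ ≠ 0 := by rwa [h, neg_ne_zero]
  have hs : ∑ p ∈ solutions μ (-w₁) w₂, kron τ p.1 (-L₁) * kron τ p.2 L₂ =
      ∑ p ∈ solutions μ w₁ w₂, -(kron τ p.1 L₁ * kron τ p.2 L₂) := by
    refine Finset.sum_equiv ((Equiv.neg Torus).prodCongr (Equiv.refl Torus)) (fun p => ?_)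
      fun p _ => ?_
    · rw [mem_solutions hD', mem_solutions hD]
      refine forall_congr' fun i => ?_
      simp
    · have := kron_neg τ (-p.1) L₁
      rw [neg_neg] at this
      simp [this]
  rw [pairing, pairing, h, hs, Finset.sum_neg_distrib, Int.cast_neg, inv_neg, neg_mul_neg]

theorem pairing_neg_right (τ : ℂ) (μ : Fin 2 → Torus) (w₁ w₂ : Fin 2 → ℤ) (L₁ L₂ : ℂ) :
    pairing τ μ w₁ (-w₂) L₁ (-L₂) = pairing τ μ w₁ w₂ L₁ L₂ := by
  rw [pairing_swap, pairing_neg_left, pairing_swap, neg_neg]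

/-- The vector `w₀ μ₁ - w₁ μ₀`. By Cramer's rule, for a solution of `w₁ s + w₂ t = μ` its value at
`w₁` is `det(w₁, w₂) t` and its value at `w₂` is `-det(w₁, w₂) s`. -/
def rowVec (μ : Fin 2 → Torus) (w : Fin 2 → ℤ) : Torus := w 0 • μ 1 - w 1 • μ 0

theorem IsSolution.fst_ne_zero {μ : Fin 2 → Torus} {w₁ w₂ : Fin 2 → ℤ} {p : Torus × Torus}
    (h : IsSolution μ w₁ w₂ p) (hv : rowVec μ w₂ ≠ 0) : p.1 ≠ 0 := by
  intro h0
  refine hv ?_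
  rw [rowVec, ← h 0, ← h 1, h0]
  module

theorem IsSolution.snd_ne_zero {μ : Fin 2 → Torus} {w₁ w₂ : Fin 2 → ℤ} {p : Torus × Torus}
    (h : IsSolution μ w₁ w₂ p) (hv : rowVec μ w₁ ≠ 0) : p.2 ≠ 0 := by
  intro h0
  refine hv ?_
  rw [rowVec, ← h 0, ← h 1, h0]
  module

theorem isSolution_smul {μ : Fin 2 → Torus} {w₁ w₂ : Fin 2 → ℤ} {n₁ n₂ : ℤ} {p : Torus × Torus} :
    IsSolution μ (n₁ • w₁) (n₂ • w₂) p ↔ IsSolution μ w₁ w₂ (n₁ • p.1, n₂ • p.2) := by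
  refine forall_congr' fun i => ?_
  simp only [Pi.smul_apply, smul_eq_mul]
  rw [smul_smul, smul_smul, mul_comm n₁, mul_comm n₂]

/-- Multiplying the rows by integers refines the solution set; by the distribution relation the
sum only changes by a factor. -/
theorem sum_solutions_smul {τ : ℂ} (hτ : 0 < τ.im) {μ : Fin 2 → Torus} {w₁ w₂ : Fin 2 → ℤ}
    (hD : rowDet w₁ w₂ ≠ 0) (hv₁ : rowVec μ w₁ ≠ 0) (hv₂ : rowVec μ w₂ ≠ 0) {n₁ n₂ : ℤ}
    (hn₁ : n₁ ≠ 0) (hn₂ : n₂ ≠ 0) {L₁ L₂ : ℂ} (hL₁ : ¬ IsPeriod τ (n₁ * L₁))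
    (hL₂ : ¬ IsPeriod τ (n₂ * L₂)) :
    ∑ p ∈ solutions μ (n₁ • w₁) (n₂ • w₂), kron τ p.1 (n₁ * L₁) * kron τ p.2 (n₂ * L₂) =
      n₁ * n₂ * ∑ p ∈ solutions μ w₁ w₂, kron τ p.1 L₁ * kron τ p.2 L₂ := by
  classical
  have hD' : rowDet (n₁ • w₁) (n₂ • w₂) ≠ 0 := by
    have : rowDet (n₁ • w₁) (n₂ • w₂) = n₁ * n₂ * rowDet w₁ w₂ := by
      simp only [rowDet, Pi.smul_apply, smul_eq_mul]; ring
    rw [this]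
    exact mul_ne_zero (mul_ne_zero hn₁ hn₂) hD
  rw [← Finset.sum_fiberwise_of_maps_to (t := solutions μ w₁ w₂)
    (g := fun p : Torus × Torus => (n₁ • p.1, n₂ • p.2))
    (fun p hp => (mem_solutions hD).2 (isSolution_smul.1 ((mem_solutions hD').1 hp))),
    Finset.mul_sum]
  refine Finset.sum_congr rfl fun q hq => ?_
  have hq' := (mem_solutions hD).1 hq
  have hset : (solutions μ (n₁ • w₁) (n₂ • w₂)).filter
      (fun p : Torus × Torus => (n₁ • p.1, n₂ • p.2) = q) = fiber n₁ q.1 ×ˢ fiber n₂ q.2 := by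
    ext p
    rw [Finset.mem_filter, Finset.mem_product, mem_solutions hD', mem_fiber hn₁, mem_fiber hn₂,
      Prod.ext_iff, isSolution_smul, and_iff_right_iff_imp]
    rintro ⟨h1, h2⟩
    simp only at h1 h2
    rw [h1, h2]
    exact hq'
  simp only [hset, Finset.sum_product]
  rw [← Finset.sum_mul_sum, sum_fiber_kron hτ hn₁ (hq'.fst_ne_zero hv₂) hL₁,
    sum_fiber_kron hτ hn₂ (hq'.snd_ne_zero hv₁) hL₂]
  ring

/-- The sum of Fay's identity over all solutions. -/
theorem sum_solutions_fay {τ : ℂ} (hτ : 0 < τ.im) {μ : Fin 2 → Torus} {w₁ w₂ w₃ : Fin 2 → ℤ}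
    (hw : w₁ + w₂ + w₃ = 0) (hD : rowDet w₁ w₂ ≠ 0)
    (hne : ∀ p, IsSolution μ w₁ w₂ p → p.1 ≠ 0 ∧ p.2 ≠ 0 ∧ p.1 ≠ p.2) {A B C : ℂ}
    (hABC : A + B + C = 0)
    (hA : ¬ IsPeriod τ A) (hB : ¬ IsPeriod τ B) (hC : ¬ IsPeriod τ C) :
    ∑ p ∈ solutions μ w₁ w₂, kron τ p.1 A * kron τ p.2 B +
      ∑ p ∈ solutions μ w₂ w₃, kron τ p.1 B * kron τ p.2 C +
      ∑ p ∈ solutions μ w₃ w₁, kron τ p.1 C * kron τ p.2 A = 0 := by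
  obtain rfl : w₃ = -(w₁ + w₂) := (neg_eq_of_add_eq_zero_right hw).symm
  obtain rfl : C = -(A + B) := (neg_eq_of_add_eq_zero_right hABC).symm
  have hD₂ : rowDet w₂ (-(w₁ + w₂)) ≠ 0 := by
    have : rowDet w₂ (-(w₁ + w₂)) = rowDet w₁ w₂ := by
      simp only [rowDet, Pi.neg_apply, Pi.add_apply]; ring
    rwa [this]
  have hD₃ : rowDet (-(w₁ + w₂)) w₁ ≠ 0 := by
    have : rowDet (-(w₁ + w₂)) w₁ = rowDet w₁ w₂ := by
      simp only [rowDet, Pi.neg_apply, Pi.add_apply]; ring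
    rwa [this]
  let e₂ : Torus × Torus ≃ Torus × Torus :=
    ⟨fun p => (p.2 - p.1, -p.1), fun p => (-p.2, p.1 - p.2), fun p => by simp, fun p => by simp⟩
  let e₃ : Torus × Torus ≃ Torus × Torus :=
    ⟨fun p => (-p.2, p.1 - p.2), fun p => (p.2 - p.1, -p.1), fun p => by simp, fun p => by simp⟩
  -- each solution for `w₁, w₂` gives one for `w₂, w₃` and one for `w₃, w₁`
  have s₂ : ∑ p ∈ solutions μ w₂ (-(w₁ + w₂)), kron τ p.1 B * kron τ p.2 (-(A + B)) =
      ∑ p ∈ solutions μ w₁ w₂, kron τ (p.2 - p.1) B * kron τ (-p.1) (-(A + B)) := by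
    symm
    refine Finset.sum_equiv e₂ (fun p => ?_) fun p _ => rfl
    rw [mem_solutions hD, mem_solutions hD₂]
    refine forall_congr' fun i => ?_
    have : w₂ i • (p.2 - p.1) + (-(w₁ + w₂)) i • -p.1 = w₁ i • p.1 + w₂ i • p.2 := by
      simp only [Pi.neg_apply, Pi.add_apply]
      module
    exact this ▸ Iff.rfl
  have s₃ : ∑ p ∈ solutions μ (-(w₁ + w₂)) w₁, kron τ p.1 (-(A + B)) * kron τ p.2 A =
      ∑ p ∈ solutions μ w₁ w₂, kron τ (-p.2) (-(A + B)) * kron τ (p.1 - p.2) A := by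
    symm
    refine Finset.sum_equiv e₃ (fun p => ?_) fun p _ => rfl
    rw [mem_solutions hD, mem_solutions hD₃]
    refine forall_congr' fun i => ?_
    have : (-(w₁ + w₂)) i • -p.2 + w₁ i • (p.1 - p.2) = w₁ i • p.1 + w₂ i • p.2 := by
      simp only [Pi.neg_apply, Pi.add_apply]
      module
    exact this ▸ Iff.rfl
  rw [s₂, s₃, ← Finset.sum_add_distrib, ← Finset.sum_add_distrib]
  refine Finset.sum_eq_zero fun p hp => ?_
  obtain ⟨h1, h2, h12⟩ := hne p ((mem_solutions hD).1 hp)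
  rw [fay hτ h1 h2 h12 hA hB (fun h => hC h.neg),
    kron_neg, kron_neg]
  ring

/-- The cocycle relation for linearly independent rows. The three rows are made to sum to zero by
multiplying each with the determinant of the other two. -/
theorem pairing_add_of_rowDet_ne_zero {τ : ℂ} (hτ : 0 < τ.im) {μ : Fin 2 → Torus}
    {w₁ w₂ w₃ : Fin 2 → ℤ} (h₁₂ : rowDet w₁ w₂ ≠ 0) (h₂₃ : rowDet w₂ w₃ ≠ 0)
    (h₁₃ : rowDet w₁ w₃ ≠ 0) (hv₁ : rowVec μ w₁ ≠ 0) (hv₂ : rowVec μ w₂ ≠ 0)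
    (hv₃ : rowVec μ w₃ ≠ 0) {L₁ L₂ L₃ : ℂ}
    (hL : rowDet w₂ w₃ * L₁ + rowDet w₃ w₁ * L₂ + rowDet w₁ w₂ * L₃ = 0)
    (hL₁ : ¬ IsPeriod τ (rowDet w₂ w₃ * L₁)) (hL₂ : ¬ IsPeriod τ (rowDet w₃ w₁ * L₂))
    (hL₃ : ¬ IsPeriod τ (rowDet w₁ w₂ * L₃)) :
    pairing τ μ w₁ w₂ L₁ L₂ + pairing τ μ w₂ w₃ L₂ L₃ = pairing τ μ w₁ w₃ L₁ L₃ := by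
  have h₃₁ : rowDet w₃ w₁ ≠ 0 := by rwa [rowDet_swap, neg_ne_zero]
  have hw : rowDet w₂ w₃ • w₁ + rowDet w₃ w₁ • w₂ + rowDet w₁ w₂ • w₃ = 0 := by
    funext i
    simp only [rowDet, Pi.add_apply, Pi.smul_apply, smul_eq_mul, Pi.zero_apply]
    fin_cases i <;> simp only [Fin.zero_eta, Fin.mk_one] <;> ring
  have hne : ∀ p, IsSolution μ (rowDet w₂ w₃ • w₁) (rowDet w₃ w₁ • w₂) p →
      p.1 ≠ 0 ∧ p.2 ≠ 0 ∧ p.1 ≠ p.2 := by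
    intro p hp
    have hp' := isSolution_smul.1 hp
    refine ⟨?_, ?_, ?_⟩
    · intro h
      exact hp'.fst_ne_zero hv₂ (by simp [h])
    · intro h
      exact hp'.snd_ne_zero hv₁ (by simp [h])
    · intro h
      have h' : ∀ i, μ i = -(rowDet w₁ w₂ * w₃ i) • p.2 := by
        intro i
        have hi := congrFun hw i
        simp only [Pi.add_apply, Pi.smul_apply, smul_eq_mul, Pi.zero_apply] at hi
        rw [← hp i, h, ← add_smul]
        congr 1
        simp only [Pi.smul_apply, smul_eq_mul]
        linarith
      refine hv₃ ?_
      rw [rowVec, h' 0, h' 1]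
      module
  have hD : rowDet (rowDet w₂ w₃ • w₁) (rowDet w₃ w₁ • w₂) ≠ 0 := by
    have : rowDet (rowDet w₂ w₃ • w₁) (rowDet w₃ w₁ • w₂) =
        rowDet w₂ w₃ * rowDet w₃ w₁ * rowDet w₁ w₂ := by
      simp only [rowDet, Pi.smul_apply, smul_eq_mul]; ring
    rw [this]
    exact mul_ne_zero (mul_ne_zero h₂₃ h₃₁) h₁₂
  have key := sum_solutions_fay hτ hw hD hne hL hL₁ hL₂ hL₃
  rw [sum_solutions_smul hτ h₁₂ hv₁ hv₂ h₂₃ h₃₁ hL₁ hL₂,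
    sum_solutions_smul hτ h₂₃ hv₂ hv₃ h₃₁ h₁₂ hL₂ hL₃,
    sum_solutions_smul hτ h₃₁ hv₃ hv₁ h₁₂ h₂₃ hL₃ hL₁] at key
  rw [← sub_eq_zero, sub_eq_add_neg, ← pairing_swap, pairing, pairing, pairing]
  have d₁ : (rowDet w₁ w₂ : ℂ) ≠ 0 := by exact_mod_cast h₁₂
  have d₂ : (rowDet w₂ w₃ : ℂ) ≠ 0 := by exact_mod_cast h₂₃
  have d₃ : (rowDet w₃ w₁ : ℂ) ≠ 0 := by exact_mod_cast h₃₁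
  field_simp
  linear_combination key

/-- The cocycle relation. Rows that are linearly dependent have to agree up to sign, as is the case
for primitive rows. -/
theorem pairing_add {τ : ℂ} (hτ : 0 < τ.im) {μ : Fin 2 → Torus}
    {w₁ w₂ w₃ : Fin 2 → ℤ} {L₁ L₂ L₃ : ℂ}
    (h₁₂ : rowDet w₁ w₂ = 0 → w₂ = w₁ ∧ L₂ = L₁ ∨ w₂ = -w₁ ∧ L₂ = -L₁)
    (h₂₃ : rowDet w₂ w₃ = 0 → w₃ = w₂ ∧ L₃ = L₂ ∨ w₃ = -w₂ ∧ L₃ = -L₂)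
    (h₁₃ : rowDet w₁ w₃ = 0 → w₃ = w₁ ∧ L₃ = L₁ ∨ w₃ = -w₁ ∧ L₃ = -L₁)
    (hv₁ : rowVec μ w₁ ≠ 0) (hv₂ : rowVec μ w₂ ≠ 0) (hv₃ : rowVec μ w₃ ≠ 0)
    (hL : rowDet w₂ w₃ * L₁ + rowDet w₃ w₁ * L₂ + rowDet w₁ w₂ * L₃ = 0)
    (hL₁ : rowDet w₂ w₃ ≠ 0 → ¬ IsPeriod τ (rowDet w₂ w₃ * L₁))
    (hL₂ : rowDet w₃ w₁ ≠ 0 → ¬ IsPeriod τ (rowDet w₃ w₁ * L₂))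
    (hL₃ : rowDet w₁ w₂ ≠ 0 → ¬ IsPeriod τ (rowDet w₁ w₂ * L₃)) :
    pairing τ μ w₁ w₂ L₁ L₂ + pairing τ μ w₂ w₃ L₂ L₃ = pairing τ μ w₁ w₃ L₁ L₃ := by
  by_cases d₁₂ : rowDet w₁ w₂ = 0
  · rw [pairing_of_rowDet_eq_zero d₁₂, zero_add]
    rcases h₁₂ d₁₂ with ⟨rfl, rfl⟩ | ⟨rfl, rfl⟩
    · rfl
    · exact pairing_neg_left ..
  by_cases d₂₃ : rowDet w₂ w₃ = 0
  · rw [pairing_of_rowDet_eq_zero d₂₃, add_zero]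
    rcases h₂₃ d₂₃ with ⟨rfl, rfl⟩ | ⟨rfl, rfl⟩
    · rfl
    · exact (pairing_neg_right ..).symm
  by_cases d₁₃ : rowDet w₁ w₃ = 0
  · rw [pairing_of_rowDet_eq_zero d₁₃, pairing_swap, neg_add_eq_zero]
    rcases h₁₃ d₁₃ with ⟨rfl, rfl⟩ | ⟨rfl, rfl⟩
    · rfl
    · exact (pairing_neg_right ..).symm
  exact pairing_add_of_rowDet_ne_zero hτ d₁₂ d₂₃ d₁₃ hv₁ hv₂ hv₃ hL (hL₁ d₂₃)
    (hL₂ (by rwa [rowDet_swap, neg_ne_zero])) (hL₃ d₁₂)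

/-! ### Taylor coefficients of the pairing -/

theorem genFun_of_ne_zero (v : Fin 2 → ℝ) {τ X : ℂ} (hX : X ≠ 0) :
    genFun v τ X = X * kron τ (toTorus v) X := by
  rw [genFun, Function.update_of_ne hX, kron_toTorus]

theorem analyticAt_genFun {τ : ℂ} (hτ : 0 < τ.im) {v : Fin 2 → ℝ} (hv : toTorus v ≠ 0) :
    AnalyticAt ℂ (genFun v τ) 0 := by
  have l := tendsto_mul_kron_zero hτ hv
  have hrem : Removable (fun X => X * kron τ (toTorus v) X) 0 := by
    refine removable_of_tendsto
      ((MeromorphicAt.id 0).mul (meromorphic_kron hτ (toTorus v) 0)) ?_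
    have := (tendsto_id (α := ℂ).mono_left (nhdsWithin_le_nhds (s := {0}ᶜ))).mul l
    rw [zero_mul] at this
    simpa using this
  obtain ⟨g, hg, h⟩ := hrem
  simp only [kron_toTorus] at h
  refine hg.congr ?_
  filter_upwards [eventually_nhdsWithin_iff.1 h] with X hX
  rcases eq_or_ne X 0 with rfl | h0
  · rw [genFun, Function.update_self]
    exact (lim_eq_of_eventuallyEq hg.continuousAt h).symm
  · rw [genFun, Function.update_of_ne h0]
    exact (hX h0).symm

theorem iteratedDeriv_comp_mul_left (f : ℂ → ℂ) (c : ℂ) (n : ℕ) (x : ℂ) :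
    iteratedDeriv n (fun x => f (c * x)) x = c ^ n * iteratedDeriv n f (c * x) := by
  induction n generalizing x with
  | zero => simp
  | succ n ih =>
    rw [iteratedDeriv_succ, funext ih, deriv_const_mul_field, deriv_comp_mul_left, smul_eq_mul,
      ← iteratedDeriv_succ, pow_succ, mul_assoc]

/-- The right-hand side of the linear system `w₁ s + w₂ t = μ` attached to the matrix with rows
`x`, `y`; it is chosen so that `rowVec` at `(c, d)` is the class of `cx + dy`. -/
def systemVec (M : Matrix (Fin 2) (Fin 2) ℝ) : Fin 2 → Torus := ![-toTorus (M 1), toTorus (M 0)]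

theorem rowVec_systemVec (M : Matrix (Fin 2) (Fin 2) ℝ) (w : Fin 2 → ℤ) :
    rowVec (systemVec M) w = toTorus ((w 0 : ℝ) • M 0 + (w 1 : ℝ) • M 1) := by
  rw [toTorus_add, toTorus_int_smul, toTorus_int_smul]
  simp [rowVec, systemVec]

theorem mem_M2_iff {V : SL(2, ℤ)} {M : Matrix (Fin 2) (Fin 2) ℝ} :
    M ∈ M2 V ↔ rowVec (systemVec M) ![0, 1] ≠ 0 ∧ rowVec (systemVec M) (V 1) ≠ 0 := by
  rw [rowVec_systemVec, rowVec_systemVec, Ne, Ne, toTorus_eq_zero, toTorus_eq_zero]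
  simp [M2]

theorem rowDet_zero_one (w : Fin 2 → ℤ) : rowDet ![0, 1] w = -w 0 := by
  simp [rowDet]

theorem pairing_zero_one (τ : ℂ) (M : Matrix (Fin 2) (Fin 2) ℝ) {w : Fin 2 → ℤ} (hw : w 0 ≠ 0)
    (L₁ L₂ : ℂ) : pairing τ (systemVec M) ![0, 1] w L₁ L₂ =
      (w 0 : ℂ)⁻¹ * ∑ r ∈ fiber (w 0) (toTorus (M 1)),
        kron τ r (-L₂) * kron τ (toTorus (M 0) + w 1 • r) L₁ := by
  have hD : rowDet ![0, 1] w ≠ 0 := by rwa [rowDet_zero_one, neg_ne_zero]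
  have h : ∑ p ∈ solutions (systemVec M) ![0, 1] w, kron τ p.1 L₁ * kron τ p.2 L₂ =
      ∑ r ∈ fiber (w 0) (toTorus (M 1)),
        -(kron τ r (-L₂) * kron τ (toTorus (M 0) + w 1 • r) L₁) := by
    symm
    refine Finset.sum_bij' (fun r _ => (toTorus (M 0) + w 1 • r, -r)) (fun p _ => -p.2)
      (fun r hr => ?_) (fun p hp => ?_) (fun r _ => neg_neg r) (fun p hp => ?_) fun r _ => ?_
    · rw [mem_solutions hD]
      rw [mem_fiber hw] at hr
      intro i
      fin_cases i <;> simp [systemVec, hr]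
    · rw [mem_fiber hw]
      have := (mem_solutions hD).1 hp 0
      simp [systemVec] at this
      simp [this]
    · have := (mem_solutions hD).1 hp 1
      simp [systemVec] at this
      refine Prod.ext ?_ (neg_neg _)
      rw [← this]
      simp
    · have := kron_neg τ r (-L₂)
      rw [neg_neg] at this
      simp only [this]
      ring
  rw [pairing, h, rowDet_zero_one, Finset.sum_neg_distrib, Int.cast_neg, inv_neg, neg_mul_neg]

theorem isCoprime_row (V : SL(2, ℤ)) : IsCoprime (V 1 1) (V 1 0) := by
  have h := V.det_coe
  rw [Matrix.det_fin_two] at h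
  exact ⟨V 0 0, -V 0 1, by linarith⟩

theorem den_row {V : SL(2, ℤ)} (hc : 0 < V 1 0) :
    ((((V 1 1 : ℚ) / (V 1 0 : ℚ)).den : ℕ) : ℤ) = V 1 0 ∧ ((V 1 1 : ℚ) / (V 1 0 : ℚ)).num = V 1 1 :=
  ⟨Rat.den_div_eq_of_coprime hc (Int.isCoprime_iff_gcd_eq_one.1 (isCoprime_row V)),
    Rat.num_div_eq_of_coprime hc (Int.isCoprime_iff_gcd_eq_one.1 (isCoprime_row V))⟩

/-- A generating function for `R_V` in the case `c > 0`. The binomial sum defining `R_V` is Leibniz'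
rule for the derivatives at `0` of `genFun v τ (-J T) * genFun u τ T`. -/
theorem exists_genFun_RPos {τ : ℂ} (hτ : 0 < τ.im) {V : SL(2, ℤ)} (hc : 0 < V 1 0)
    {M : Matrix (Fin 2) (Fin 2) ℝ} (hM : M ∈ M2 V) {z : ℂ} (hz : autFactor V z ≠ 0) :
    ∃ P : ℂ → ℂ, AnalyticAt ℂ P 0 ∧
      (∀ T, T ≠ 0 → P T = T ^ 2 *
        pairing τ (systemVec M) ![0, 1] (V 1) T (autFactor V z * T)) ∧
      ∀ l, RPos V l z M τ = iteratedDeriv (l + 1) P 0 / ((l + 1).factorial : ℂ) := by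
  obtain ⟨hden, hnum⟩ := den_row hc
  set J := autFactor V z with hJ
  set c := (V 1 0).natAbs with hcdef
  have hcc : ((c : ℕ) : ℤ) = V 1 0 := Int.natAbs_of_nonneg hc.le
  have hden' : ((V 1 1 : ℚ) / (V 1 0 : ℚ)).den = c := by omega
  have hcr : ((V 1 0 : ℤ) : ℝ) = c := by exact_mod_cast congrArg (Int.cast : ℤ → ℝ) hcc.symm
  have hcC : ((V 1 0 : ℤ) : ℂ) = c := by exact_mod_cast congrArg (Int.cast : ℤ → ℂ) hcc.symm
  have hJ' : -J ≠ 0 := neg_ne_zero.2 hz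
  let v (j : ℕ × ℕ) : Fin 2 → ℝ := (1 / (c : ℝ)) • (![(j.1 : ℝ), (j.2 : ℝ)] + M 1)
  let u (j : ℕ × ℕ) : Fin 2 → ℝ := ((V 1 1 : ℝ) / c) • (![(j.1 : ℝ), (j.2 : ℝ)] + M 1) - -M 0
  have hu : ∀ j, toTorus (u j) = toTorus (M 0) + V 1 1 • toTorus (v j) := by
    intro j
    rw [← toTorus_int_smul, ← toTorus_add]
    congr 1
    funext i
    simp only [u, v, Pi.sub_apply, Pi.neg_apply, Pi.add_apply, Pi.smul_apply, smul_eq_mul]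
    ring
  have hfib : ∀ j ∈ Finset.range c ×ˢ Finset.range c, V 1 0 • toTorus (v j) = toTorus (M 1) := by
    intro j hj
    refine (mem_image_toTorus_div hc.ne' (M 1)).1 ⟨j, hj, ?_⟩
    rw [hcr]
  have hv0 : ∀ j ∈ Finset.range c ×ˢ Finset.range c, toTorus (v j) ≠ 0 := by
    intro j hj h
    have := hfib j hj
    rw [h, smul_zero] at this
    exact hM.1 (toTorus_eq_zero.1 this.symm)
  have hu0 : ∀ j ∈ Finset.range c ×ˢ Finset.range c, toTorus (u j) ≠ 0 := by
    intro j hj h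
    rw [hu] at h
    refine hM.2 (toTorus_eq_zero.1 ?_)
    rw [toTorus_add, toTorus_int_smul, toTorus_int_smul, ← hfib j hj, smul_comm, ← smul_add, h,
      smul_zero]
  have hsum : ∀ g : Torus → ℂ, ∑ r ∈ fiber (V 1 0) (toTorus (M 1)), g r =
      ∑ j ∈ Finset.range c ×ˢ Finset.range c, g (toTorus (v j)) := by
    intro g
    rw [sum_fiber_toTorus hc.ne', Finset.sum_product, hcr]
  have ana₁ : ∀ j ∈ Finset.range c ×ˢ Finset.range c,
      AnalyticAt ℂ (fun T => genFun (v j) τ (-J * T)) 0 := fun j hj =>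
    (analyticAt_genFun hτ (hv0 j hj)).comp_of_eq (f := fun T : ℂ => -J * T) (by fun_prop) (by simp)
  have ana₂ : ∀ j ∈ Finset.range c ×ˢ Finset.range c,
      AnalyticAt ℂ (fun T => genFun (u j) τ T) 0 := fun j hj => analyticAt_genFun hτ (hu0 j hj)
  refine ⟨fun T => ((c : ℂ)⁻¹ * (-J)⁻¹) * ∑ j ∈ Finset.range c ×ˢ Finset.range c,
    genFun (v j) τ (-J * T) * genFun (u j) τ T, ?_, ?_, ?_⟩
  · exact analyticAt_const.mul (Finset.analyticAt_fun_sum (𝕜 := ℂ)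
      (f := fun j T => genFun (v j) τ (-J * T) * genFun (u j) τ T) _
      fun j hj => (ana₁ j hj).mul (ana₂ j hj))
  · intro T hT
    change (c : ℂ)⁻¹ * (-J)⁻¹ * _ = _
    rw [pairing_zero_one τ M hc.ne', hsum, hcC, mul_assoc, mul_left_comm (T ^ 2)]
    congr 1
    rw [Finset.mul_sum, Finset.mul_sum]
    refine Finset.sum_congr rfl fun j _ => ?_
    rw [genFun_of_ne_zero _ (mul_ne_zero hJ' hT), genFun_of_ne_zero _ hT, hu, neg_mul]
    field_simp
  · intro l
    have hder : iteratedDeriv (l + 1) (fun T => ((c : ℂ)⁻¹ * (-J)⁻¹) *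
        ∑ j ∈ Finset.range c ×ˢ Finset.range c, genFun (v j) τ (-J * T) * genFun (u j) τ T) 0 =
        ((c : ℂ)⁻¹ * (-J)⁻¹) * ∑ j ∈ Finset.range c ×ˢ Finset.range c,
          ∑ i ∈ Finset.range (l + 1 + 1), ((l + 1).choose i : ℂ) *
            ((-J) ^ i * iteratedDeriv i (genFun (v j) τ) 0) *
              iteratedDeriv (l + 1 - i) (genFun (u j) τ) 0 := by
      rw [iteratedDeriv_const_mul_field, iteratedDeriv_fun_sum
        (f := fun j T => genFun (v j) τ (-J * T) * genFun (u j) τ T) fun j hj =>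
          ((ana₁ j hj).mul (ana₂ j hj)).contDiffAt]
      congr 1
      refine Finset.sum_congr rfl fun j hj => ?_
      rw [iteratedDeriv_fun_mul (ana₁ j hj).contDiffAt (ana₂ j hj).contDiffAt]
      simp only [iteratedDeriv_comp_mul_left, mul_zero]
    rw [hder, RPos, Finset.sum_comm, div_mul_eq_mul_div]
    congr 1
    rw [Finset.mul_sum, Finset.mul_sum]
    refine Finset.sum_congr rfl fun i hi => ?_
    have hi' : i ≤ l + 1 := by
      have := Finset.mem_range.1 hi
      omega
    have hpi : (2 * Real.pi * Complex.I : ℂ) ≠ 0 := Complex.two_pi_I_ne_zero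
    rw [dedekindSum, hden', hnum, ← Finset.sum_product', zpow_sub₀ hJ', zpow_natCast, zpow_one]
    simp only [Finset.mul_sum]
    refine Finset.sum_congr rfl fun j _ => ?_
    have e1 : (2 * Real.pi * Complex.I : ℂ) ^ (l + 1) =
        (2 * Real.pi * Complex.I) ^ i * (2 * Real.pi * Complex.I) ^ (l + 1 - i) := by
      rw [← pow_add, Nat.add_sub_cancel' hi']
    rw [e1, ellBernoulli, ellBernoulli]
    change _ * (_ * (_ / _) * (_ * (iteratedDeriv i (genFun (v j) τ) 0 / _ *
      (iteratedDeriv (l + 1 - i) (genFun (u j) τ) 0 / _)))) = _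
    generalize iteratedDeriv i (genFun (v j) τ) 0 = X
    generalize iteratedDeriv (l + 1 - i) (genFun (u j) τ) 0 = Y
    generalize (2 * Real.pi * Complex.I : ℂ) = w at hpi
    have hwi := pow_ne_zero i hpi
    have hwl := pow_ne_zero (l + 1 - i) hpi
    generalize w ^ i = w₁ at hwi ⊢
    generalize w ^ (l + 1 - i) = w₂ at hwl ⊢
    field_simp

/-- A generating function for `R_V`. -/
theorem exists_genFun_R {τ : ℂ} (hτ : 0 < τ.im) {V : SL(2, ℤ)}
    {M : Matrix (Fin 2) (Fin 2) ℝ} (hM : M ∈ M2 V) {z : ℂ} (hz : autFactor V z ≠ 0) :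
    ∃ P : ℂ → ℂ, AnalyticAt ℂ P 0 ∧
      (∀ T, T ≠ 0 → P T = T ^ 2 *
        pairing τ (systemVec M) ![0, 1] (V 1) T (autFactor V z * T)) ∧
      ∀ l, R V l z M τ = iteratedDeriv (l + 1) P 0 / ((l + 1).factorial : ℂ) := by
  rcases lt_trichotomy (V 1 0) 0 with hc | hc | hc
  · have hrow : (-V) 1 = -V 1 := by
      funext i
      simp
    have hJ : autFactor (-V) z = -autFactor V z := by
      simp [autFactor]; ring
    have hc' : 0 < (-V) 1 0 := by rw [hrow]; simpa using hc
    have hM' : M ∈ M2 (-V) := by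
      rw [mem_M2_iff] at hM ⊢
      refine ⟨hM.1, ?_⟩
      rw [hrow, rowVec, Pi.neg_apply, Pi.neg_apply, neg_smul, neg_smul, ← neg_sub', neg_ne_zero]
      exact hM.2
    obtain ⟨P, h1, h2, h3⟩ := exists_genFun_RPos hτ hc' hM' (z := z) (by rwa [hJ, neg_ne_zero])
    refine ⟨P, h1, fun T hT => ?_, fun l => ?_⟩
    · rw [h2 T hT, hrow, hJ, neg_mul, pairing_neg_right]
    · rw [R, if_neg hc.not_gt, if_neg hc.ne, h3]
  · refine ⟨fun _ => 0, analyticAt_const, fun T _ => ?_, fun l => ?_⟩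
    · rw [pairing_of_rowDet_eq_zero (by rw [rowDet_zero_one, hc, neg_zero]), mul_zero]
    · rw [R, if_neg (by omega), if_pos hc]
      simp
  · obtain ⟨P, h1, h2, h3⟩ := exists_genFun_RPos hτ hc hM hz
    exact ⟨P, h1, h2, fun l => by rw [R, if_pos hc, h3]⟩

/-! ### The cocycle relation for `R` -/

theorem eventually_not_isPeriod {τ : ℂ} (hτ : 0 < τ.im) {c : ℂ} (hc : c ≠ 0) :
    ∀ᶠ T in 𝓝[≠] (0 : ℂ), ¬ IsPeriod τ (c * T) := by
  have h := ((differentiable_theta hτ) 0).hasDerivAt.eventually_ne (c := 0)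
    (deriv_theta_zero_ne_zero hτ)
  have t := tendsto_mul_nhdsNE hc 0
  rw [mul_zero] at t
  filter_upwards [t.eventually h] with T hT hp
  exact hT (theta_eq_zero_of_isPeriod hp)

theorem bottomRow_mul (V₂ V₁ : SL(2, ℤ)) (i : Fin 2) :
    (V₂ * V₁) 1 i = V₂ 1 0 * V₁ 0 i + V₂ 1 1 * V₁ 1 i := by
  simp [Matrix.mul_apply, Fin.sum_univ_two]

theorem det_eq_one (V : SL(2, ℤ)) : V 0 0 * V 1 1 - V 0 1 * V 1 0 = 1 := by
  rw [← Matrix.det_fin_two]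
  exact V.det_coe

theorem rowDet_bottomRow_mul (V₂ V₁ : SL(2, ℤ)) :
    rowDet (V₁ 1) ((V₂ * V₁) 1) = -V₂ 1 0 := by
  rw [rowDet, bottomRow_mul, bottomRow_mul]
  linear_combination -V₂ 1 0 * det_eq_one V₁

theorem bottomRow_of_eq_zero {V : SL(2, ℤ)} (h : V 1 0 = 0) : V 1 1 = 1 ∨ V 1 1 = -1 := by
  have hd := det_eq_one V
  rw [h, mul_zero, sub_zero] at hd
  exact Int.isUnit_iff.1 (IsUnit.of_mul_eq_one (V 0 0) (by rw [mul_comm]; exact hd))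

theorem act_row (V : SL(2, ℤ)) (M : Matrix (Fin 2) (Fin 2) ℝ) (i : Fin 2) :
    act V M i = (V i 0 : ℝ) • M 0 + (V i 1 : ℝ) • M 1 := by
  funext j
  simp [act, Matrix.mul_apply, Fin.sum_univ_two]

/-- Changing the matrix `M` by `V₁` amounts to changing the rows by `V₁`. -/
theorem pairing_act (τ : ℂ) (V₁ V₂ : SL(2, ℤ)) (M : Matrix (Fin 2) (Fin 2) ℝ) (L₁ L₂ : ℂ) :
    pairing τ (systemVec (act V₁ M)) ![0, 1] (V₂ 1) L₁ L₂ =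
      pairing τ (systemVec M) (V₁ 1) ((V₂ * V₁) 1) L₁ L₂ := by
  have hdet : rowDet (V₁ 1) ((V₂ * V₁) 1) = rowDet ![0, 1] (V₂ 1) := by
    rw [rowDet_bottomRow_mul, rowDet_zero_one]
  by_cases hD : rowDet ![0, 1] (V₂ 1) = 0
  · rw [pairing_of_rowDet_eq_zero hD, pairing_of_rowDet_eq_zero (hdet.trans hD)]
  have hs : solutions (systemVec (act V₁ M)) ![0, 1] (V₂ 1) =
      solutions (systemVec M) (V₁ 1) ((V₂ * V₁) 1) := by
    ext ⟨s, t⟩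
    rw [mem_solutions hD, mem_solutions (by rwa [hdet])]
    have e0 : systemVec (act V₁ M) 0 =
        -(V₁ 1 0 • toTorus (M 0) + V₁ 1 1 • toTorus (M 1)) := by
      rw [← toTorus_int_smul, ← toTorus_int_smul, ← toTorus_add, ← act_row]
      rfl
    have e1 : systemVec (act V₁ M) 1 = V₁ 0 0 • toTorus (M 0) + V₁ 0 1 • toTorus (M 1) := by
      rw [← toTorus_int_smul, ← toTorus_int_smul, ← toTorus_add, ← act_row]
      rfl
    have f0 : systemVec M 0 = -toTorus (M 1) := rfl
    have f1 : systemVec M 1 = toTorus (M 0) := rfl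
    have hd := det_eq_one V₁
    simp only [IsSolution, Fin.forall_fin_two, e0, e1, f0, f1, bottomRow_mul, Matrix.cons_val_zero,
      Matrix.cons_val_one]
    generalize toTorus (M 0) = x
    generalize toTorus (M 1) = y
    generalize V₁ 0 0 = a at *
    generalize V₁ 0 1 = b at *
    generalize V₁ 1 0 = c at *
    generalize V₁ 1 1 = d at *
    constructor
    · rintro ⟨h0, h1⟩
      constructor
      · linear_combination (norm := module) a • h0 + c • h1 + hd • (-y)
      · linear_combination (norm := module) b • h0 + d • h1 + hd • x
    · rintro ⟨h0, h1⟩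
      constructor
      · linear_combination (norm := module) d • h0 - c • h1 + hd • (-(V₂ 1 0 • t))
      · linear_combination (norm := module) a • h1 - b • h0 + hd • (-(s + V₂ 1 1 • t))
  rw [pairing, pairing, hdet, hs]

theorem autFactor_mul {V₁ V₂ : SL(2, ℤ)} {z : ℂ} (hz : autFactor V₁ z ≠ 0) :
    autFactor V₂ (moebius V₁ z) * autFactor V₁ z = autFactor (V₂ * V₁) z := by
  have h : moebius V₁ z * autFactor V₁ z = V₁ 0 0 * z + V₁ 0 1 := div_mul_cancel₀ _ hz
  simp only [autFactor, bottomRow_mul] at h ⊢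
  push_cast
  linear_combination (V₂ 1 0 : ℂ) * h

/-- The cocycle relation between the generating functions. -/
theorem pairing_bottomRow_add {τ : ℂ} (hτ : 0 < τ.im) {V₁ V₂ : SL(2, ℤ)}
    {M : Matrix (Fin 2) (Fin 2) ℝ} (hM : M ∈ M2 (V₂ * V₁)) (hM₁ : M ∈ M2 V₁) {z : ℂ}
    (hz₁ : autFactor V₁ z ≠ 0) (hz : autFactor (V₂ * V₁) z ≠ 0) :
    ∀ᶠ T in 𝓝[≠] (0 : ℂ),
      pairing τ (systemVec M) ![0, 1] (V₁ 1) T (autFactor V₁ z * T) +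
        pairing τ (systemVec M) (V₁ 1) ((V₂ * V₁) 1) (autFactor V₁ z * T)
          (autFactor (V₂ * V₁) z * T) =
      pairing τ (systemVec M) ![0, 1] ((V₂ * V₁) 1) T (autFactor (V₂ * V₁) z * T) := by
  rw [mem_M2_iff] at hM hM₁
  have hev : ∀ (n : ℤ) (c : ℂ), c ≠ 0 →
      ∀ᶠ T in 𝓝[≠] (0 : ℂ), n ≠ 0 → ¬ IsPeriod τ (n * (c * T)) := by
    intro n c hc
    by_cases hn : n = 0
    · exact .of_forall fun T h => (h hn).elim
    · filter_upwards [eventually_not_isPeriod hτ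
        (mul_ne_zero (Int.cast_ne_zero.2 hn : (n : ℂ) ≠ 0) hc)] with T hT _
      rwa [← mul_assoc]
  have base : ∀ (V : SL(2, ℤ)) (T : ℂ), rowDet ![0, 1] (V 1) = 0 →
      V 1 = ![0, 1] ∧ autFactor V z * T = T ∨ V 1 = -![0, 1] ∧ autFactor V z * T = -T := by
    intro V T h
    rw [rowDet_zero_one, neg_eq_zero] at h
    rcases bottomRow_of_eq_zero h with h1 | h1
    · refine .inl ⟨?_, by simp [autFactor, h, h1]⟩
      funext i
      fin_cases i
      · exact h
      · exact h1
    · refine .inr ⟨?_, by simp [autFactor, h, h1]⟩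
      funext i
      fin_cases i
      · simpa using h
      · simpa using h1
  filter_upwards [hev (rowDet (V₁ 1) ((V₂ * V₁) 1)) 1 one_ne_zero,
    hev (rowDet ((V₂ * V₁) 1) ![0, 1]) _ hz₁, hev (rowDet ![0, 1] (V₁ 1)) _ hz] with T h1 h2 h3
  rw [one_mul] at h1
  refine pairing_add hτ (base V₁ T) (fun h => ?_) (base (V₂ * V₁) T) hM.1 hM₁.2 hM.2 ?_ h1 h2 h3
  · rw [rowDet_bottomRow_mul, neg_eq_zero] at h
    have hr : ∀ i, (V₂ * V₁) 1 i = V₂ 1 1 * V₁ 1 i := fun i => by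
      rw [bottomRow_mul, h, zero_mul, zero_add]
    have hj : autFactor (V₂ * V₁) z = V₂ 1 1 * autFactor V₁ z := by
      simp only [autFactor, hr]
      push_cast
      ring
    rcases bottomRow_of_eq_zero h with h' | h'
    · exact .inl ⟨funext fun i => by rw [hr, h', one_mul], by rw [hj, h']; simp⟩
    · exact .inr ⟨funext fun i => by rw [hr, h', neg_one_mul]; rfl, by rw [hj, h']; simp⟩
  · simp only [rowDet, autFactor, Matrix.cons_val_zero, Matrix.cons_val_one]
    push_cast
    ring

/-- The cocycle relation for `R`, by comparing Taylor coefficients of the generating functions.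
Those of `V₂` are evaluated at `j(V₁, z) T`, which produces the factor `j(V₁, z) ^ (l - 1)`. -/
theorem R_mul {τ : ℂ} (hτ : 0 < τ.im) {l : ℕ} (hl : 0 < l) {V₁ V₂ : SL(2, ℤ)}
    {M : Matrix (Fin 2) (Fin 2) ℝ} (hM : M ∈ M2 (V₂ * V₁) ∩ M2 V₁) {z : ℂ}
    (hz₁ : autFactor V₁ z ≠ 0) (hz : autFactor (V₂ * V₁) z ≠ 0) :
    R V₁ l z M τ + autFactor V₁ z ^ (l - 1) * R V₂ l (moebius V₁ z) (act V₁ M) τ =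
      R (V₂ * V₁) l z M τ := by
  have hj := autFactor_mul (V₂ := V₂) hz₁
  have hz₂ : autFactor V₂ (moebius V₁ z) ≠ 0 := left_ne_zero_of_mul (by rwa [hj])
  have hM₂ : act V₁ M ∈ M2 V₂ := by
    refine ⟨by rw [act_row]; exact hM.2.2, ?_⟩
    have : (V₂ 1 0 : ℝ) • act V₁ M 0 + (V₂ 1 1 : ℝ) • act V₁ M 1 =
        ((V₂ * V₁) 1 0 : ℝ) • M 0 + ((V₂ * V₁) 1 1 : ℝ) • M 1 := by
      rw [act_row, act_row, bottomRow_mul, bottomRow_mul]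
      push_cast
      module
    rw [this]
    exact hM.1.2
  obtain ⟨P, hP, hPT, hPl⟩ := exists_genFun_R hτ hM.1 hz
  obtain ⟨P₁, hP₁, hPT₁, hPl₁⟩ := exists_genFun_R hτ hM.2 hz₁
  obtain ⟨P₂, hP₂, hPT₂, hPl₂⟩ := exists_genFun_R hτ hM₂ hz₂
  have hP₂' : AnalyticAt ℂ (fun T => P₂ (autFactor V₁ z * T)) 0 :=
    hP₂.comp_of_eq (f := fun T : ℂ => autFactor V₁ z * T) (by fun_prop) (by simp)
  have hsum : (fun T => P₁ T + (autFactor V₁ z ^ 2)⁻¹ * P₂ (autFactor V₁ z * T)) =ᶠ[𝓝[≠] 0] P := by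
    filter_upwards [pairing_bottomRow_add hτ hM.1 hM.2 hz₁ hz, self_mem_nhdsWithin] with T h hT
    rw [hPT₁ T hT, hPT₂ _ (mul_ne_zero hz₁ hT), hPT T hT, ← h, pairing_act,
      ← mul_assoc _ (autFactor V₁ z) T, hj]
    field_simp
  have hA : AnalyticAt ℂ (fun T => P₁ T + (autFactor V₁ z ^ 2)⁻¹ * P₂ (autFactor V₁ z * T)) 0 :=
    hP₁.add (analyticAt_const.mul hP₂')
  have hsum' : (fun T => P₁ T + (autFactor V₁ z ^ 2)⁻¹ * P₂ (autFactor V₁ z * T)) =ᶠ[𝓝 0] P :=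
    (hA.frequently_eq_iff_eventually_eq hP).1 hsum.frequently
  have hder := hsum'.iteratedDeriv_eq (l + 1)
  rw [iteratedDeriv_fun_add (g := fun T => (autFactor V₁ z ^ 2)⁻¹ * P₂ (autFactor V₁ z * T))
    hP₁.contDiffAt (analyticAt_const.mul hP₂').contDiffAt, iteratedDeriv_const_mul_field,
    iteratedDeriv_comp_mul_left, mul_zero] at hder
  rw [hPl₁, hPl₂, hPl, ← hder]
  obtain ⟨k, rfl⟩ : ∃ k, l = k + 1 := ⟨l - 1, by omega⟩
  rw [Nat.add_sub_cancel, show k + 1 + 1 = k + 2 from rfl, pow_add _ k 2]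
  field_simp

end EllipticCocycle

theorem mainTheorem3 (τ : ℂ) (hτ : 0 < τ.im) (l : ℕ) (hl : 0 < l)
    (V V₁ V₂ : SL(2, ℤ)) (hV : V = V₂ * V₁)
    (M : Matrix (Fin 2) (Fin 2) ℝ)
    (hM : M ∈ EllipticCocycle.M2 V ∩ EllipticCocycle.M2 V₁)
    (z : ℂ) (hz₁ : EllipticCocycle.autFactor V₁ z ≠ 0) (hz : EllipticCocycle.autFactor V z ≠ 0) :
    EllipticCocycle.R V₁ l z M τ +
        EllipticCocycle.autFactor V₁ z ^ (l - 1) *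
          EllipticCocycle.R V₂ l (EllipticCocycle.moebius V₁ z) (EllipticCocycle.act V₁ M) τ =
      EllipticCocycle.R V l z M τ := by
  subst hV
  exact EllipticCocycle.R_mul hτ hl hM hz₁ hz
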